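/- Let $d,p\ge 1$, $\phi_0\in\mathbb{R}^d$, let $\Omega\in\mathbb{R}^{d\times d}$ be positive definite, $\nu>2$, and let $A_1,\dots,A_p\in\mathbb{R}^{d\times d}$ satisfy the stability condition $\det(I_d-\sum_{i=1}^pA_ix^i)\neq 0$ for all complex $|x|\le 1$. Notation. For a positive definite $S\in\mathbb{R}^{n\times n}$ and $\nu>2$, $t_n(m,S,\nu)$ is the $n$-dimensional Student's $t$-distribution with mean $m$, covariance matrix $S$ and $\nu$ degrees of freedom, i.e. with density $$\frac{\Gamma(\frac{n+\nu}{2})}{\sqrt{\pi^n(\nu-2)^n}\,\Gamma(\frac{\nu}{2})}\det(S)^{-1/2}\Bigl(1+\frac{(y-m)'S^{-1}(y-m)}{\nu-2}\Bigr)^{-(n+\nu)/2}.$$ Put $\mathbf{A}_p=[A_1:\cdots:A_p]$, let $\mathbf{A}\in\mathbb{R}^{dp\times dp}$ be the companion matrix with first block row $\mathbf{A}_p$ and identity blocks below the block diagonal, and let $\mathbf{\Omega}\in\mathbb{R}^{dp\times dp}$ have upper left block $\Omega$ and zeros elsewhere. Define $\mu=(I_d-\sum_iA_i)^{-1}\phi_0$,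 $\mathrm{vec}(\Sigma_p)=(I_{(dp)^2}-\mathbf{A}\otimes\mathbf{A})^{-1}\mathrm{vec}(\mathbf{\Omega})$, $\Sigma_1$ the upper left $d\times d$ block of $\Sigma_p$, $\Sigma_{1p}=\mathbf{A}_p\Sigma_p$, and $$\Sigma_{p+1}=\begin{bmatrix}\Sigma_1&\Sigma_{1p}\\ \Sigma_{1p}'&\Sigma_p\end{bmatrix}.$$ For $\mathbf{z}\in\mathbb{R}^{dp}$ let $\mu(\mathbf{z})=\phi_0+\mathbf{A}_p\mathbf{z}$ and $$\Omega(\mathbf{z})=\frac{\nu-2+(\mathbf{z}-\mathbf{1}_p\otimes\mu)'\Sigma_p^{-1}(\mathbf{z}-\mathbf{1}_p\otimes\mu)}{\nu-2+dp}\,\Omega .$$ Theorem. There is a Markov transition kernel on $\mathbb{R}^{dp}$ for which $t_{dp}(\mathbf{1}_p\otimes\mu,\Sigma_p,\nu)$ is a stationary distribution, and such that for every initial distribution on $\mathbb{R}^{dp}$ there is a process $(z_t)_{t\ge 1-p}$ in $\mathbb{R}^d$ whose $p$-vectors $\mathbf{z}_t=(z_t,\dots,z_{t-p+1})$, $t=0,1,2,\dots$,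 form a time-homogeneous Markov chain with this kernel, where $\mathbf{z}_0$ has the given initial distribution and the following hold. (i) For $t\ge1$ the conditional distribution of $z_t$ given $\mathbf{z}_{t-1}$ is $t_d(\mu(\mathbf{z}_{t-1}),\Omega(\mathbf{z}_{t-1}),\nu+dp)$. If $\mathbf{z}_0\sim t_{dp}(\mathbf{1}_p\otimes\mu,\Sigma_p,\nu)$, then $(z_t,\mathbf{z}_{t-1})\sim t_{d(p+1)}(\mathbf{1}_{p+1}\otimes\mu,\Sigma_{p+1},\nu)$ for all $t\ge 1$. (ii) For $t\ge1$, $$z_t=\phi_0+\sum_{i=1}^pA_iz_{t-i}+\Omega_t^{1/2}\varepsilon_t,\qquad \Omega_t=\Omega(\mathbf{z}_{t-1}),$$ where $\Omega_t^{1/2}$ is the symmetric positive definite square root of $\Omega_t$, the $\varepsilon_t$, $t\ge1$, are independent and identically $t_d(0,I_d,\nu+dp)$ distributed, and each $\varepsilon_t$ is independent of $\{z_s:1-p\le s<t\}$. In particular, the matrices $\Sigma_p$ and $\Sigma_{p+1}$ are positive definite. -/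

import Mathlib

open MeasureTheory ProbabilityTheory Matrix
open scoped Kronecker MatrixOrder

noncomputable section

namespace StudentVAR

section StudentT

variable {ι : Type*} [Fintype ι] [DecidableEq ι]

/-- The Lebesgue density of the multivariate Student `t` distribution, parametrized by its
mean `m`, its covariance matrix `S` and its degrees of freedom `ν > 2`. -/
def studentTPDF (m : ι → ℝ) (S : Matrix ι ι ℝ) (ν : ℝ) (y : ι → ℝ) : ℝ :=
  Real.Gamma ((Fintype.card ι + ν) / 2) /
      (Real.sqrt (Real.pi ^ Fintype.card ι * (ν - 2) ^ Fintype.card ι) * Real.Gamma (ν / 2)) *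
    S.det ^ (-(1 / 2) : ℝ) *
    (1 + ((y - m) ⬝ᵥ (S⁻¹ *ᵥ (y - m))) / (ν - 2)) ^ (-((Fintype.card ι + ν) / 2))

/-- The measure on `ι → ℝ` with density `studentTPDF m S ν`. -/
def studentT (m : ι → ℝ) (S : Matrix ι ι ℝ) (ν : ℝ) : Measure (ι → ℝ) :=
  volume.withDensity fun y => ENNReal.ofReal (studentTPDF m S ν y)

/-- `Q` is the `t`-distribution with mean `m`, (positive definite) covariance matrix `S` and
`ν > 2` degrees of freedom: it has the `t`-density, and its parameters are what their names say. -/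
structure IsStudentT (Q : Measure (ι → ℝ)) (m : ι → ℝ) (S : Matrix ι ι ℝ) (ν : ℝ) : Prop where
  posDef : S.PosDef
  two_lt : 2 < ν
  eq_studentT : Q = studentT m S ν
  isProbabilityMeasure : IsProbabilityMeasure Q
  memLp : ∀ a, MemLp (fun y : ι → ℝ => y a) 2 Q
  mean : ∀ a, ∫ y, y a ∂Q = m a
  cov : ∀ a b, cov[fun y : ι → ℝ => y a, fun y : ι → ℝ => y b; Q] = S a b

end StudentT

section Parameters

variable {d p : ℕ}

/-- The stability condition `det (I - A₁ x - ⋯ - A_p x ^ p) ≠ 0` for complex `|x| ≤ 1`.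
The matrix `A i` is the coefficient of lag `i + 1`. -/
def Stable (A : Fin p → Matrix (Fin d) (Fin d) ℝ) : Prop :=
  ∀ x : ℂ, ‖x‖ ≤ 1 →
    (1 - ∑ i : Fin p, x ^ ((i : ℕ) + 1) • (A i).map (fun r : ℝ => (r : ℂ))).det ≠ 0

/-- `μ = (I - ∑ A_i)⁻¹ φ₀`. -/
def mu (φ₀ : Fin d → ℝ) (A : Fin p → Matrix (Fin d) (Fin d) ℝ) : Fin d → ℝ :=
  (1 - ∑ i, A i)⁻¹ *ᵥ φ₀

/-- `1_p ⊗ μ`. -/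
def stackMu (φ₀ : Fin d → ℝ) (A : Fin p → Matrix (Fin d) (Fin d) ℝ) : Fin p × Fin d → ℝ :=
  fun ja => mu φ₀ A ja.2

/-- The `d × dp` matrix `[A₁ : ⋯ : A_p]`. -/
def coeffRow (A : Fin p → Matrix (Fin d) (Fin d) ℝ) : Matrix (Fin d) (Fin p × Fin d) ℝ :=
  Matrix.of fun a jb => A jb.1 a jb.2

/-- The `dp × dp` companion matrix. -/
def companion (A : Fin p → Matrix (Fin d) (Fin d) ℝ) :
    Matrix (Fin p × Fin d) (Fin p × Fin d) ℝ :=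
  Matrix.of fun ia jb =>
    if (ia.1 : ℕ) = 0 then A jb.1 ia.2 jb.2
    else if (ia.1 : ℕ) = (jb.1 : ℕ) + 1 ∧ ia.2 = jb.2 then 1 else 0

/-- The `dp × dp` matrix with upper left block `Ω` and all other blocks zero. -/
def bigOmega (p : ℕ) (Ω : Matrix (Fin d) (Fin d) ℝ) :
    Matrix (Fin p × Fin d) (Fin p × Fin d) ℝ :=
  Matrix.of fun ia jb => if (ia.1 : ℕ) = 0 ∧ (jb.1 : ℕ) = 0 then Ω ia.2 jb.2 else 0

/-- The matrix `Σ_p` with `vec Σ_p = (I - 𝐀 ⊗ 𝐀)⁻¹ vec 𝛀`. -/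
def sigmaP (A : Fin p → Matrix (Fin d) (Fin d) ℝ) (Ω : Matrix (Fin d) (Fin d) ℝ) :
    Matrix (Fin p × Fin d) (Fin p × Fin d) ℝ :=
  Matrix.of fun ia jb =>
    ((1 - companion A ⊗ₖ companion A)⁻¹ *ᵥ (bigOmega p Ω).vec) (jb, ia)

/-- `Σ₁ = Σ(0)`, the upper left `d × d` block of `Σ_p`. -/
def sigmaOne [NeZero p] (A : Fin p → Matrix (Fin d) (Fin d) ℝ) (Ω : Matrix (Fin d) (Fin d) ℝ) :
    Matrix (Fin d) (Fin d) ℝ :=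
  Matrix.of fun a b => sigmaP A Ω (0, a) (0, b)

/-- `Σ_{1p} = [Σ(1) : ⋯ : Σ(p)] = [A₁ : ⋯ : A_p] Σ_p`. -/
def sigmaOneP (A : Fin p → Matrix (Fin d) (Fin d) ℝ) (Ω : Matrix (Fin d) (Fin d) ℝ) :
    Matrix (Fin d) (Fin p × Fin d) ℝ :=
  coeffRow A * sigmaP A Ω

/-- `Σ_{p+1}`, in blocks; `ℝ^{d(p+1)}` is indexed by `Fin d ⊕ Fin p × Fin d`. -/
def sigmaSucc [NeZero p] (A : Fin p → Matrix (Fin d) (Fin d) ℝ) (Ω : Matrix (Fin d) (Fin d) ℝ) :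
    Matrix (Fin d ⊕ Fin p × Fin d) (Fin d ⊕ Fin p × Fin d) ℝ :=
  Matrix.fromBlocks (sigmaOne A Ω) (sigmaOneP A Ω) (sigmaOneP A Ω)ᵀ (sigmaP A Ω)

/-- `1_{p+1} ⊗ μ`. -/
def stackMuSucc (φ₀ : Fin d → ℝ) (A : Fin p → Matrix (Fin d) (Fin d) ℝ) :
    Fin d ⊕ Fin p × Fin d → ℝ :=
  Sum.elim (mu φ₀ A) (stackMu φ₀ A)

/-- The conditional mean `μ(𝐳) = φ₀ + [A₁ : ⋯ : A_p] 𝐳`. -/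
def condMean (φ₀ : Fin d → ℝ) (A : Fin p → Matrix (Fin d) (Fin d) ℝ)
    (v : Fin p × Fin d → ℝ) : Fin d → ℝ :=
  φ₀ + coeffRow A *ᵥ v

/-- The conditional covariance matrix
`Ω(𝐳) = (ν - 2 + (𝐳 - 1_p ⊗ μ)' Σ_p⁻¹ (𝐳 - 1_p ⊗ μ)) / (ν - 2 + dp) • Ω`. -/
def condCov (φ₀ : Fin d → ℝ) (A : Fin p → Matrix (Fin d) (Fin d) ℝ)
    (Ω : Matrix (Fin d) (Fin d) ℝ) (ν : ℝ) (v : Fin p × Fin d → ℝ) :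
    Matrix (Fin d) (Fin d) ℝ :=
  ((ν - 2 + (v - stackMu φ₀ A) ⬝ᵥ ((sigmaP A Ω)⁻¹ *ᵥ (v - stackMu φ₀ A))) /
    (ν - 2 + (d : ℝ) * (p : ℝ))) • Ω

end Parameters

section Trajectories

variable {𝒮 : Type*} {d : ℕ}

/-- The `p`-vector `𝐳_t = (z_t, …, z_{t-p+1})` of a process `z`. -/
def stack (p : ℕ) (z : ℤ → 𝒮 → Fin d → ℝ) (t : ℤ) (ω : 𝒮) : Fin p × Fin d → ℝ :=
  fun ja => z (t - ((ja.1 : ℕ) : ℤ)) ω ja.2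

/-- The vector `𝐳_t⁺ = (z_t, 𝐳_{t-1})`. -/
def stackSucc (p : ℕ) (z : ℤ → 𝒮 → Fin d → ℝ) (t : ℤ) (ω : 𝒮) : Fin d ⊕ Fin p × Fin d → ℝ :=
  Sum.elim (z t ω) (stack p z (t - 1) ω)

/-- The `σ`-algebra generated by the `z_s` with `1 - p ≤ s < t`, that is, by the
past `{z_{t-j}, j > 0}` of a process whose `p`-vector starts at time `0`. -/
abbrev past (p : ℕ) (z : ℤ → 𝒮 → Fin d → ℝ) (t : ℤ) : MeasurableSpace 𝒮 :=
  ⨆ s ∈ Set.Ico (1 - (p : ℤ)) t, MeasurableSpace.comap (z s) inferInstance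

/-- `Z₀, Z₁, …` is a time-homogeneous Markov chain with transition kernel `K`: the conditional
distribution of `Z_{t+1}` given the whole history `(Z₀, …, Z_t)` is `K(Z_t, ·)`. -/
structure IsMarkovChain {E : Type*} [MeasurableSpace E] [MeasurableSpace 𝒮] (P : Measure 𝒮)
    (Z : ℕ → 𝒮 → E) (K : Kernel E E) : Prop where
  measurable : ∀ t, Measurable (Z t)
  hasCondDistrib : ∀ t, HasCondDistrib (Z (t + 1)) (fun ω (s : Finset.Iic t) => Z s ω)
    (K.comap (fun h : Finset.Iic t → E => h ⟨t, Finset.mem_Iic.2 le_rfl⟩)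
      (measurable_pi_apply _)) P

end Trajectories

end StudentVAR

end

noncomputable section

namespace StudentVAR

/-! ### Stability, the companion matrix and the discrete Lyapunov equation. -/

section LinearAlgebra

open Filter Topology

attribute [local instance] Matrix.linftyOpNormedRing Matrix.linftyOpNormedAlgebra

/-! The heart of the matter is that a multivariate t density on a block vector `(u, v)` factors into
the t density of `v` and a conditional t density of `u`. The conditional mean is affine in `v`, the
degrees of freedom grow by the dimension of `v`, and the conditional covariance is a fixed matrix
scaled by a Mahalanobis term in `v` (`studentTPDF_regressionCov`). The autoregression is built so
that its transition law is exactly this conditional density.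

Stability puts the spectrum of the companion matrix inside the unit disc, so its powers vanish and
the Lyapunov equation determines `sigmaP` uniquely. That equation does three jobs. Read as a
quadratic form, it gives positive definiteness (`sigmaP_posDef`). Its first block says that
`sigmaSucc` is the covariance of a regression on the past with residual covariance `Ω`
(`sigmaSucc_eq_regressionCov`). Its remaining blocks say that deleting the oldest observation from
`sigmaSucc` returns `sigmaP` (`sigmaSucc_submatrix_oldestFirst`). Hence, starting from the t law of
the past, one transition yields the joint t law of `p + 1` observations
(`compProd_noiseKernel_nextObs`), and its marginal on the newest `p` of them is the initial law
again (`invariant_noiseKernel_nextState`).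

The analytic input on t laws is a beta integral, computed by mixing Gaussians over a Gamma variable,
for normalization and second moment; symmetry then gives the standard mean and covariance, and
affine maps the general case.

The process solves the recursion driven by independent standard t errors on an infinite product
space. Each error is independent of all earlier coordinates, which gives the Markov property, the
conditional law and the independence from the past. -/

/-- The powers of a complex matrix with spectral radius less than one tend to zero. -/
theorem tendsto_matrix_pow_zero {n : Type*} [Fintype n] [DecidableEq n] (M : Matrix n n ℂ)
    (hM : ∀ z ∈ spectrum ℂ M, ‖z‖ < 1) : Tendsto (fun k : ℕ => M ^ k) atTop (𝓝 0) := by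
  rcases isEmpty_or_nonempty n with h | h
  · have : (fun k : ℕ => M ^ k) = fun _ => 0 := by
      funext k; exact Subsingleton.elim _ _
    rw [this]; exact tendsto_const_nhds
  have hr : spectralRadius ℂ M < ((1 : NNReal) : ENNReal) :=
    spectrum.spectralRadius_lt_of_forall_lt M fun z hz => by
      simpa [← NNReal.coe_lt_coe] using hM z hz
  obtain ⟨r, h1, h2⟩ := exists_between hr
  lift r to NNReal using h2.ne_top
  have h2' : r < 1 := by exact_mod_cast h2
  -- Gelfand's formula: the k-th roots of the norms fall below `r < 1` eventually, so the powers
  -- decay geometrically.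
  have hg := spectrum.pow_nnnorm_pow_one_div_tendsto_nhds_spectralRadius M
  have hev : ∀ᶠ k : ℕ in atTop, ‖M ^ k‖ ≤ (r : ℝ) ^ k := by
    filter_upwards [hg.eventually_lt_const h1, eventually_gt_atTop 0] with k hk hk0
    have hk' : ((‖M ^ k‖₊ : ENNReal) ^ (1 / k : ℝ)) ^ (k : ℝ) ≤ (r : ENNReal) ^ (k : ℝ) :=
      ENNReal.rpow_le_rpow hk.le (by positivity)
    rw [← ENNReal.rpow_mul, one_div_mul_cancel (by positivity), ENNReal.rpow_one,
      ENNReal.rpow_natCast] at hk'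
    exact_mod_cast hk'
  exact squeeze_zero_norm' hev (tendsto_pow_atTop_nhds_zero_of_lt_one r.2 (by exact_mod_cast h2'))

variable {d p : ℕ}

/-- The eigenvalues of the companion matrix of a stable autoregression lie in the open unit
disc. -/
theorem norm_lt_one_of_mem_spectrum_companion [NeZero p] {A : Fin p → Matrix (Fin d) (Fin d) ℝ}
    (hA : Stable A) (l : ℂ) (hl : l ∈ spectrum ℂ ((companion A).map (fun r : ℝ => (r : ℂ)))) :
    ‖l‖ < 1 := by
  by_contra! hl1
  have hl0 : l ≠ 0 := by rintro rfl; norm_num at hl1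
  rw [spectrum.mem_iff, Matrix.isUnit_iff_isUnit_det, isUnit_iff_ne_zero, not_not] at hl
  obtain ⟨v, hv0, hv⟩ := Matrix.exists_mulVec_eq_zero_iff.2 hl
  have hv' : (companion A).map (fun r : ℝ => (r : ℂ)) *ᵥ v = l • v := by
    rw [sub_mulVec, Algebra.algebraMap_eq_smul_one, smul_mulVec, one_mulVec, sub_eq_zero] at hv
    exact hv.symm
  -- The lower block rows force an eigenvector to have blocks `l⁻¹ ^ i * w`; the first block row
  -- then makes `w` a null vector of the autoregressive polynomial at `l⁻¹`, a point of the closed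
  -- unit disc.
  have hshift : ∀ (i : ℕ) (hi : i + 1 < p) (a : Fin d),
      v (⟨i, by omega⟩, a) = l * v (⟨i + 1, hi⟩, a) := by
    intro i hi a
    have := congrFun hv' (⟨i + 1, hi⟩, a)
    simp only [mulVec, dotProduct, Matrix.map_apply, companion, Matrix.of_apply, Pi.smul_apply,
      smul_eq_mul, Nat.add_eq_zero_iff, one_ne_zero, and_false, if_false] at this
    rw [← this, Finset.sum_eq_single (⟨i, by omega⟩, a)]
    · simp
    · rintro ⟨j, b⟩ - hjb
      rw [if_neg]
      · simp
      · rintro ⟨h1, h2⟩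
        apply hjb
        ext1
        · ext; simp only at h1 ⊢; omega
        · exact h2.symm
    · simp
  have hpow : ∀ (i : ℕ) (hi : i < p) (a : Fin d), v (⟨i, hi⟩, a) = l⁻¹ ^ i * v (0, a) := by
    intro i
    induction i with
    | zero => intro hi a; simp
    | succ i ih =>
      intro hi a
      have h1 := hshift i hi a
      rw [ih (by omega) a] at h1
      rw [pow_succ', mul_assoc, h1, inv_mul_cancel_left₀ hl0]
  set w : Fin d → ℂ := fun a => v (0, a) with hw
  have hw0 : w ≠ 0 := by
    intro h
    apply hv0
    ext ⟨i, a⟩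
    rw [hpow i i.2 a]
    simp [show v (0, a) = 0 from congrFun h a]
  refine hA l⁻¹ ?_ ?_
  · rw [norm_inv]; exact inv_le_one_of_one_le₀ hl1
  · refine Matrix.exists_mulVec_eq_zero_iff.1 ⟨w, hw0, ?_⟩
    rw [sub_mulVec, one_mulVec, sub_eq_zero]
    ext a
    have h0 := congrFun hv' (0, a)
    simp only [mulVec, dotProduct, Matrix.map_apply, companion, Matrix.of_apply, Pi.smul_apply,
      smul_eq_mul, Fin.val_zero, if_true, Fintype.sum_prod_type] at h0
    rw [Matrix.sum_mulVec, Finset.sum_apply]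
    have h1 : w a = l⁻¹ * (l * v (0, a)) := by rw [inv_mul_cancel_left₀ hl0]
    rw [h1, ← h0, Finset.mul_sum]
    refine Finset.sum_congr rfl fun i _ => ?_
    simp only [mulVec, dotProduct, Matrix.smul_apply, Matrix.map_apply, smul_eq_mul]
    rw [Finset.mul_sum]
    refine Finset.sum_congr rfl fun b _ => ?_
    rw [show v (i, b) = l⁻¹ ^ (i : ℕ) * w b from hpow i i.2 b]
    ring

/-- The powers of the companion matrix of a stable autoregression tend to zero. -/
theorem tendsto_companion_pow [NeZero p] {A : Fin p → Matrix (Fin d) (Fin d) ℝ} (hA : Stable A) :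
    Tendsto (fun k : ℕ => companion A ^ k) atTop (𝓝 0) := by
  have h := tendsto_matrix_pow_zero _ (norm_lt_one_of_mem_spectrum_companion hA)
  have hre : Continuous fun M : Matrix (Fin p × Fin d) (Fin p × Fin d) ℂ => M.map Complex.re :=
    continuous_id.matrix_map Complex.continuous_re
  have h0 : (0 : Matrix (Fin p × Fin d) (Fin p × Fin d) ℂ).map Complex.re = 0 := by ext; simp
  have h' := (hre.tendsto 0).comp h
  rw [h0] at h'
  refine h'.congr fun k => ?_
  have : (companion A).map (fun r : ℝ => (r : ℂ)) ^ k
      = (companion A ^ k).map (fun r : ℝ => (r : ℂ)) :=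
    (Matrix.map_pow (companion A) Complex.ofRealHom k).symm
  ext i j
  simp [this]

/-- A fixed point of `X ↦ M X Nᵀ` vanishes when the powers of `M` and `N` tend to zero. -/
theorem eq_zero_of_eq_mul_mul_transpose {n : Type*} [Fintype n] [DecidableEq n]
    {M X : Matrix n n ℝ} (hM : Tendsto (fun k : ℕ => M ^ k) atTop (𝓝 0)) (hX : X = M * X * Mᵀ) :
    X = 0 := by
  have hk : ∀ k : ℕ, X = M ^ k * X * (M ^ k)ᵀ := by
    intro k
    induction k with
    | zero => simp
    | succ k ih =>
      nth_rw 1 [hX]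
      nth_rw 1 [ih]
      rw [pow_succ', transpose_mul]
      simp only [Matrix.mul_assoc]
  have ht : Tendsto (fun k : ℕ => M ^ k * X * (M ^ k)ᵀ) atTop (𝓝 (0 * X * 0ᵀ)) :=
    (hM.mul_const X).mul ((Continuous.matrix_transpose continuous_id).tendsto _ |>.comp hM)
  simp only [zero_mul] at ht
  exact tendsto_nhds_unique (tendsto_const_nhds.congr hk) ht

/-- A null vector, unstacked column by column into a matrix, is a fixed point of `X ↦ 𝐀 X 𝐀ᵀ`, and
iterating this map sends it to zero. -/
theorem isUnit_one_sub_companion_kronecker [NeZero p] {A : Fin p → Matrix (Fin d) (Fin d) ℝ}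
    (hA : Stable A) : IsUnit (1 - companion A ⊗ₖ companion A) := by
  rw [Matrix.isUnit_iff_isUnit_det, isUnit_iff_ne_zero]
  intro h
  obtain ⟨v, hv0, hv⟩ := Matrix.exists_mulVec_eq_zero_iff.2 h
  apply hv0
  set X : Matrix (Fin p × Fin d) (Fin p × Fin d) ℝ := Matrix.of fun i j => v (j, i)
  have hXv : X.vec = v := rfl
  have hX : X = companion A * X * (companion A)ᵀ := by
    rw [← Matrix.vec_inj, ← kronecker_mulVec_vec, hXv]
    rwa [sub_mulVec, one_mulVec, sub_eq_zero] at hv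
  rw [← hXv, eq_zero_of_eq_mul_mul_transpose (tendsto_companion_pow hA) hX]
  rfl

/-- `Σ_p` solves the discrete Lyapunov equation of the companion matrix. -/
theorem sigmaP_lyapunov [NeZero p] {A : Fin p → Matrix (Fin d) (Fin d) ℝ} (hA : Stable A)
    (Ω : Matrix (Fin d) (Fin d) ℝ) :
    sigmaP A Ω = companion A * sigmaP A Ω * (companion A)ᵀ + bigOmega p Ω := by
  have hv : (sigmaP A Ω).vec
      = (1 - companion A ⊗ₖ companion A)⁻¹ *ᵥ (bigOmega p Ω).vec := rfl
  have h := congrArg (fun v => (1 - companion A ⊗ₖ companion A) *ᵥ v) hv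
  simp only [mulVec_mulVec] at h
  rw [Matrix.mul_nonsing_inv _
    ((Matrix.isUnit_iff_isUnit_det _).1 (isUnit_one_sub_companion_kronecker hA)), one_mulVec,
    sub_mulVec, one_mulVec, kronecker_mulVec_vec, sub_eq_iff_eq_add, ← Matrix.vec_add,
    Matrix.vec_inj, add_comm] at h
  exact h

/-- The transpose solves the same Lyapunov equation, so the difference solves the homogeneous one
and vanishes. -/
theorem sigmaP_isSymm [NeZero p] {A : Fin p → Matrix (Fin d) (Fin d) ℝ} (hA : Stable A)
    {Ω : Matrix (Fin d) (Fin d) ℝ} (hΩ : Ω.IsSymm) : (sigmaP A Ω)ᵀ = sigmaP A Ω := by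
  have hO : (bigOmega p Ω)ᵀ = bigOmega p Ω := by
    ext i j
    simp [bigOmega, and_comm, hΩ.apply]
  rw [← sub_eq_zero]
  refine eq_zero_of_eq_mul_mul_transpose (tendsto_companion_pow hA) ?_
  nth_rw 1 [sigmaP_lyapunov hA]
  nth_rw 2 [sigmaP_lyapunov hA]
  rw [transpose_add, hO, transpose_mul, transpose_mul, transpose_transpose]
  simp only [Matrix.mul_sub, Matrix.sub_mul, Matrix.mul_assoc]
  abel

end LinearAlgebra

/-! ### Block covariance matrices of regressions. -/

section BlockMatrices

theorem transpose_eq_of_posDef {m : Type*} {S : Matrix m m ℝ} (hS : S.PosDef) : Sᵀ = S := by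
  simpa using hS.isHermitian.eq

variable {m n : Type*} [Fintype m] [Fintype n] [DecidableEq m] [DecidableEq n]

/-- The covariance matrix of `(B v + u, v)` for uncorrelated `u` and `v` with covariance matrices
`C` and `D`. -/
def regressionCov (B : Matrix m n ℝ) (C : Matrix m m ℝ) (D : Matrix n n ℝ) :
    Matrix (m ⊕ n) (m ⊕ n) ℝ :=
  fromBlocks (B * D * Bᵀ + C) (B * D) (D * Bᵀ) D

/-- Congruence by a unit triangular matrix reduces definiteness, determinant and inverse to the
block diagonal case. -/
theorem regressionCov_eq (B : Matrix m n ℝ) (C : Matrix m m ℝ) (D : Matrix n n ℝ) :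
    regressionCov B C D = fromBlocks 1 B 0 1 * fromBlocks C 0 0 D * (fromBlocks 1 B 0 1)ᵀ := by
  simp [regressionCov, fromBlocks_multiply, fromBlocks_transpose, add_comm]

theorem posDef_fromBlocks_diagonal_iff {m n : Type*} [Fintype m] [Fintype n]
    {C : Matrix m m ℝ} {D : Matrix n n ℝ} :
    (fromBlocks C 0 0 D).PosDef ↔ C.PosDef ∧ D.PosDef := by
  constructor
  · intro h
    exact ⟨h.submatrix (e := Sum.inl) Sum.inl_injective,
      h.submatrix (e := Sum.inr) Sum.inr_injective⟩
  · rintro ⟨hC, hD⟩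
    refine .of_dotProduct_mulVec_pos ?_ fun x hx => ?_
    · exact isHermitian_fromBlocks_iff.2 ⟨hC.1, by simp, by simp, hD.1⟩
    · obtain ⟨u, v, rfl⟩ : ∃ u v, x = Sum.elim u v := ⟨_, _, (Sum.elim_comp_inl_inr x).symm⟩
      have hu := hC.posSemidef.dotProduct_mulVec_nonneg u
      have hv := hD.posSemidef.dotProduct_mulVec_nonneg v
      simp only [star_trivial] at hu hv
      simp only [star_trivial, fromBlocks_mulVec, Sum.elim_comp_inl, Sum.elim_comp_inr,
        zero_mulVec, add_zero, zero_add, sumElim_dotProduct_sumElim]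
      rcases eq_or_ne u 0 with rfl | hu0
      · have hv0 : v ≠ 0 := by
          rintro rfl; apply hx; ext (i | i) <;> rfl
        have := hD.dotProduct_mulVec_pos hv0
        simp only [star_trivial] at this
        linarith
      · have := hC.dotProduct_mulVec_pos hu0
        simp only [star_trivial] at this
        linarith

theorem isUnit_fromBlocks_one (B : Matrix m n ℝ) :
    IsUnit (fromBlocks (1 : Matrix m m ℝ) B 0 (1 : Matrix n n ℝ)) := by
  rw [Matrix.isUnit_iff_isUnit_det, det_fromBlocks_zero₂₁]; simp

theorem posDef_regressionCov_iff {B : Matrix m n ℝ} {C : Matrix m m ℝ} {D : Matrix n n ℝ} :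
    (regressionCov B C D).PosDef ↔ C.PosDef ∧ D.PosDef := by
  rw [regressionCov_eq, ← posDef_fromBlocks_diagonal_iff,
    ← conjTranspose_eq_transpose_of_trivial, ← star_eq_conjTranspose,
    Matrix.IsUnit.posDef_star_right_conjugate_iff (isUnit_fromBlocks_one B)]

theorem det_regressionCov (B : Matrix m n ℝ) (C : Matrix m m ℝ) (D : Matrix n n ℝ) :
    (regressionCov B C D).det = C.det * D.det := by
  rw [regressionCov_eq, det_mul, det_mul, det_transpose, det_fromBlocks_zero₂₁,
    det_fromBlocks_zero₂₁]
  simp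

theorem inv_fromBlocks_one (B : Matrix m n ℝ) :
    (fromBlocks (1 : Matrix m m ℝ) B 0 (1 : Matrix n n ℝ))⁻¹ = fromBlocks 1 (-B) 0 1 := by
  apply Matrix.inv_eq_right_inv
  simp [fromBlocks_multiply]

/-- The Mahalanobis form of a joint vector splits into those of the residual and the regressor. -/
theorem dotProduct_inv_regressionCov {B : Matrix m n ℝ} {C : Matrix m m ℝ} {D : Matrix n n ℝ}
    (hC : C.PosDef) (hD : D.PosDef) (u : m → ℝ) (v : n → ℝ) :
    Sum.elim u v ⬝ᵥ ((regressionCov B C D)⁻¹ *ᵥ Sum.elim u v)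
      = (u - B *ᵥ v) ⬝ᵥ (C⁻¹ *ᵥ (u - B *ᵥ v)) + v ⬝ᵥ (D⁻¹ *ᵥ v) := by
  have hd : (fromBlocks C 0 0 D)⁻¹ = fromBlocks C⁻¹ 0 0 D⁻¹ := by
    apply Matrix.inv_eq_right_inv
    rw [fromBlocks_multiply]
    simp [Matrix.mul_nonsing_inv _ ((Matrix.isUnit_iff_isUnit_det _).1 hC.isUnit),
      Matrix.mul_nonsing_inv _ ((Matrix.isUnit_iff_isUnit_det _).1 hD.isUnit)]
  have hU : fromBlocks (1 : Matrix m m ℝ) (-B) 0 (1 : Matrix n n ℝ) *ᵥ Sum.elim u v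
      = Sum.elim (u - B *ᵥ v) v := by
    rw [fromBlocks_mulVec]
    simp [neg_mulVec, sub_eq_add_neg]
  rw [regressionCov_eq, Matrix.mul_inv_rev, Matrix.mul_inv_rev, ← transpose_nonsing_inv,
    inv_fromBlocks_one, ← mulVec_mulVec, dotProduct_mulVec, vecMul_transpose, ← mulVec_mulVec, hU,
    hd, fromBlocks_mulVec]
  simp

/-- Every positive definite block matrix is the covariance matrix of a regression. -/
theorem exists_eq_regressionCov {S : Matrix (m ⊕ n) (m ⊕ n) ℝ} (hS : S.PosDef) :
    ∃ B C, S = regressionCov B C S.toBlocks₂₂ ∧ C.PosDef ∧ S.toBlocks₂₂.PosDef := by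
  have hD : S.toBlocks₂₂.PosDef := hS.submatrix (e := Sum.inr) Sum.inr_injective
  have hu := (Matrix.isUnit_iff_isUnit_det _).1 hD.isUnit
  have hT : Sᵀ = S := by simpa using hS.isHermitian.eq
  have hDT : (S.toBlocks₂₂)ᵀ = S.toBlocks₂₂ := by simpa using hD.isHermitian.eq
  have h21 : (S.toBlocks₁₂)ᵀ = S.toBlocks₂₁ := by
    ext i j; exact congrFun (congrFun hT (Sum.inr i)) (Sum.inl j)
  -- The regression coefficient is `S₁₂ S₂₂⁻¹` and the residual covariance is the Schur complement.
  have h : S = regressionCov (S.toBlocks₁₂ * S.toBlocks₂₂⁻¹)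
      (S.toBlocks₁₁ - S.toBlocks₁₂ * S.toBlocks₂₂⁻¹ * S.toBlocks₂₁) S.toBlocks₂₂ := by
    conv_lhs => rw [← fromBlocks_toBlocks S]
    rw [regressionCov, transpose_mul, transpose_nonsing_inv, hDT, h21,
      Matrix.mul_assoc _ S.toBlocks₂₂⁻¹ S.toBlocks₂₂, Matrix.nonsing_inv_mul _ hu, Matrix.mul_one,
      ← Matrix.mul_assoc S.toBlocks₂₂, Matrix.mul_nonsing_inv _ hu, Matrix.one_mul,
      ← Matrix.mul_assoc]
    congr 1
    abel
  refine ⟨_, _, h, ?_, hD⟩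
  rw [h] at hS
  exact (posDef_regressionCov_iff.1 hS).1

end BlockMatrices

/-! ### Positive definiteness and block Toeplitz structure of the stationary covariance. -/

section Covariance

open Filter Topology

attribute [local instance] Matrix.linftyOpNormedRing Matrix.linftyOpNormedAlgebra

variable {d p : ℕ} [NeZero p] {A : Fin p → Matrix (Fin d) (Fin d) ℝ}
  {Ω : Matrix (Fin d) (Fin d) ℝ}

theorem bigOmega_quadratic (x : Fin p × Fin d → ℝ) :
    x ⬝ᵥ (bigOmega p Ω *ᵥ x) = (fun a => x (0, a)) ⬝ᵥ (Ω *ᵥ fun a => x (0, a)) := by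
  have h0 : ∀ i : Fin p, (i : ℕ) = 0 ↔ i = 0 := fun i => by
    rw [← Fin.val_eq_zero_iff]
  simp only [dotProduct, mulVec, bigOmega, Matrix.of_apply, Fintype.sum_prod_type, h0]
  rw [Finset.sum_eq_single 0]
  · refine Finset.sum_congr rfl fun a _ => ?_
    rw [Finset.sum_eq_single 0]
    · simp
    · intro j _ hj; simp [hj]
    · simp
  · intro i _ hi; simp [hi]
  · simp

/-- The Lyapunov equation as an energy identity: applying `𝐀ᵀ` loses exactly the `Ω`-energy of the
first block. -/
theorem sigmaP_quadratic (hA : Stable A) (x : Fin p × Fin d → ℝ) :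
    x ⬝ᵥ (sigmaP A Ω *ᵥ x) = ((companion A)ᵀ *ᵥ x) ⬝ᵥ (sigmaP A Ω *ᵥ ((companion A)ᵀ *ᵥ x))
      + (fun a => x (0, a)) ⬝ᵥ (Ω *ᵥ fun a => x (0, a)) := by
  nth_rw 1 [sigmaP_lyapunov hA]
  rw [add_mulVec, dotProduct_add, bigOmega_quadratic, ← mulVec_mulVec, ← mulVec_mulVec,
    dotProduct_mulVec, mulVec_transpose]

/-- The energy does not increase along `x, 𝐀ᵀx, (𝐀ᵀ)²x, …` and tends to zero, so it starts
nonnegative. -/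
theorem sigmaP_quadratic_nonneg (hA : Stable A) (hΩ : Ω.PosDef) (x : Fin p × Fin d → ℝ) :
    0 ≤ x ⬝ᵥ (sigmaP A Ω *ᵥ x) := by
  have hstep : ∀ k : ℕ, (((companion A) ^ k)ᵀ *ᵥ x) ⬝ᵥ (sigmaP A Ω *ᵥ (((companion A) ^ k)ᵀ *ᵥ x))
      ≤ x ⬝ᵥ (sigmaP A Ω *ᵥ x) := by
    intro k
    induction k with
    | zero => simp
    | succ k ih =>
      refine le_trans ?_ ih
      have h := sigmaP_quadratic (Ω := Ω) hA (((companion A) ^ k)ᵀ *ᵥ x)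
      have h2 := hΩ.posSemidef.dotProduct_mulVec_nonneg
        (fun a => (((companion A) ^ k)ᵀ *ᵥ x) (0, a))
      simp only [star_trivial] at h2
      rw [h, pow_succ, transpose_mul, ← mulVec_mulVec]
      linarith
  have ht : Tendsto (fun k : ℕ => (((companion A) ^ k)ᵀ *ᵥ x) ⬝ᵥ
      (sigmaP A Ω *ᵥ (((companion A) ^ k)ᵀ *ᵥ x))) atTop
      (𝓝 (((0 : Matrix (Fin p × Fin d) (Fin p × Fin d) ℝ)ᵀ *ᵥ x) ⬝ᵥ (sigmaP A Ω *ᵥ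
        ((0 : Matrix (Fin p × Fin d) (Fin p × Fin d) ℝ)ᵀ *ᵥ x)))) := by
    have hc : Continuous fun M : Matrix (Fin p × Fin d) (Fin p × Fin d) ℝ =>
        (Mᵀ *ᵥ x) ⬝ᵥ (sigmaP A Ω *ᵥ (Mᵀ *ᵥ x)) := by fun_prop
    exact (hc.tendsto 0).comp (tendsto_companion_pow hA)
  simp only [transpose_zero, zero_mulVec, zero_dotProduct] at ht
  exact le_of_tendsto' ht hstep

theorem companion_transpose_mulVec (x : Fin p × Fin d → ℝ) (h : ∀ a, x (0, a) = 0)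
    (i : ℕ) (hi : i + 1 < p) (a : Fin d) :
    ((companion A)ᵀ *ᵥ x) (⟨i, by omega⟩, a) = x (⟨i + 1, hi⟩, a) := by
  simp only [mulVec, dotProduct, transpose_apply, companion, Matrix.of_apply]
  rw [Finset.sum_eq_single (⟨i + 1, hi⟩, a)]
  · simp
  · rintro ⟨j, b⟩ - hjb
    rcases eq_or_ne j 0 with rfl | hj
    · simp [h b]
    · rw [if_neg (by simpa using hj), if_neg, zero_mul]
      rintro ⟨h1, h2⟩
      apply hjb
      ext1
      · ext; simpa using h1
      · exact h2
  · simp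

theorem sigmaP_posDef (hA : Stable A) (hΩ : Ω.PosDef) : (sigmaP A Ω).PosDef := by
  refine .of_dotProduct_mulVec_pos ?_ fun x hx => ?_
  · rw [IsHermitian, conjTranspose_eq_transpose_of_trivial]
    exact sigmaP_isSymm hA (transpose_eq_of_posDef hΩ)
  · rw [star_trivial]
    refine lt_of_le_of_ne (sigmaP_quadratic_nonneg hA hΩ x) fun h0 => hx ?_
    -- A vector of zero energy has zero first block, and `𝐀ᵀ` maps it to another such vector. With
    -- the first block gone, `𝐀ᵀ` merely shifts the blocks up, so the induction on the block index
    -- has to range over all vectors `y`.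
    have key : ∀ (i : ℕ) (hi : i < p) (y : Fin p × Fin d → ℝ), y ⬝ᵥ (sigmaP A Ω *ᵥ y) = 0 →
        ∀ a, y (⟨i, hi⟩, a) = 0 := by
      intro i
      induction i with
      | zero =>
        intro hi y hy
        have h1 := sigmaP_quadratic (Ω := Ω) hA y
        have h2 := sigmaP_quadratic_nonneg hA hΩ ((companion A)ᵀ *ᵥ y)
        have h3 : (fun a => y (0, a)) = 0 := by
          by_contra h
          have := hΩ.dotProduct_mulVec_pos h
          simp only [star_trivial] at this
          linarith
        exact fun a => congrFun h3 a
      | succ i ih =>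
        intro hi y hy a
        have h1 := sigmaP_quadratic (Ω := Ω) hA y
        have h2 := sigmaP_quadratic_nonneg hA hΩ ((companion A)ᵀ *ᵥ y)
        have h4 : (fun a => y (0, a)) = 0 := by
          by_contra h
          have := hΩ.dotProduct_mulVec_pos h
          simp only [star_trivial] at this
          linarith
        have h5 := ih (by omega) ((companion A)ᵀ *ᵥ y) (by
          rw [h4] at h1; simp only [zero_dotProduct, add_zero] at h1; rw [← h1, hy]) a
        rwa [companion_transpose_mulVec y (fun a => congrFun h4 a) i hi a] at h5
    ext ⟨i, a⟩
    exact key i i.2 x h0.symm a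

theorem companion_mul_zero (X : Matrix (Fin p × Fin d) (Fin p × Fin d) ℝ) (a : Fin d)
    (k : Fin p × Fin d) : (companion A * X) (0, a) k = (coeffRow A * X) a k := by
  simp [Matrix.mul_apply, companion, coeffRow]

theorem companion_mul_succ (X : Matrix (Fin p × Fin d) (Fin p × Fin d) ℝ) (i : ℕ) (hi : i + 1 < p)
    (a : Fin d) (k : Fin p × Fin d) :
    (companion A * X) (⟨i + 1, hi⟩, a) k = X (⟨i, by omega⟩, a) k := by
  rw [Matrix.mul_apply, Finset.sum_eq_single (⟨i, by omega⟩, a)]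
  · simp [companion]
  · rintro ⟨j, b⟩ - hjb
    simp only [companion, Matrix.of_apply]
    rw [if_neg (by simp), if_neg, zero_mul]
    rintro ⟨h1, h2⟩
    apply hjb
    ext1
    · ext; simpa using h1.symm
    · exact h2.symm
  · simp

theorem mul_companion_transpose_zero (X : Matrix (Fin d) (Fin p × Fin d) ℝ) (a b : Fin d) :
    (X * (companion A)ᵀ) a (0, b) = (X * (coeffRow A)ᵀ) a b := by
  simp [Matrix.mul_apply, companion, coeffRow]

theorem mul_companion_transpose_succ {m : Type*} (X : Matrix m (Fin p × Fin d) ℝ) (a : m)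
    (i : ℕ) (hi : i + 1 < p) (b : Fin d) :
    (X * (companion A)ᵀ) a (⟨i + 1, hi⟩, b) = X a (⟨i, by omega⟩, b) := by
  rw [Matrix.mul_apply, Finset.sum_eq_single (⟨i, by omega⟩, b)]
  · simp [companion]
  · rintro ⟨j, c⟩ - hjb
    simp only [companion, transpose_apply, Matrix.of_apply]
    rw [if_neg (by simp), if_neg, mul_zero]
    rintro ⟨h1, h2⟩
    apply hjb
    ext1
    · ext; simpa using h1.symm
    · exact h2.symm
  · simp

/-- Only the upper left block needs an argument: it is the first diagonal block of the Lyapunov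
equation. -/
theorem sigmaSucc_eq_regressionCov (hA : Stable A) (hΩ : Ω.PosDef) :
    sigmaSucc A Ω = regressionCov (coeffRow A) Ω (sigmaP A Ω) := by
  have hS := sigmaP_isSymm hA (Ω := Ω) (transpose_eq_of_posDef hΩ)
  rw [sigmaSucc, regressionCov, sigmaOneP, transpose_mul, hS]
  congr 1
  ext a b
  rw [sigmaOne, Matrix.of_apply]
  conv_lhs => rw [sigmaP_lyapunov hA]
  rw [Matrix.add_apply, Matrix.add_apply, Matrix.mul_assoc, companion_mul_zero,
    ← Matrix.mul_assoc, mul_companion_transpose_zero]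
  simp [bigOmega]

theorem sigmaSucc_posDef (hA : Stable A) (hΩ : Ω.PosDef) : (sigmaSucc A Ω).PosDef := by
  rw [sigmaSucc_eq_regressionCov hA hΩ, posDef_regressionCov_iff]
  exact ⟨hΩ, sigmaP_posDef hA hΩ⟩

/-- The reordering of `(z_t, z_{t-1}, …, z_{t-p})` that puts the oldest observation first and
keeps the order of the others. -/
def oldestFirstFun (d p : ℕ) [NeZero p] : Fin d ⊕ Fin p × Fin d → Fin d ⊕ Fin p × Fin d
  | Sum.inl a => Sum.inr (⟨p - 1, Nat.sub_lt (NeZero.pos p) one_pos⟩, a)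
  | Sum.inr (i, a) =>
    if (i : ℕ) = 0 then Sum.inl a else Sum.inr (⟨i - 1, (Nat.sub_le _ _).trans_lt i.2⟩, a)

theorem oldestFirstFun_injective : Function.Injective (oldestFirstFun d p) := by
  rintro (a | ⟨i, a⟩) (b | ⟨j, b⟩) h
  · simpa [oldestFirstFun] using h
  · simp only [oldestFirstFun] at h
    split_ifs at h with h0
    simp only [Sum.inr.injEq, Prod.mk.injEq, Fin.mk.injEq] at h
    omega
  · simp only [oldestFirstFun] at h
    split_ifs at h with h0
    simp only [Sum.inr.injEq, Prod.mk.injEq, Fin.mk.injEq] at h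
    omega
  · simp only [oldestFirstFun] at h
    split_ifs at h with h0 h1 h1
    · simp only [Sum.inl.injEq] at h
      simp only [Sum.inr.injEq, Prod.mk.injEq, Fin.ext_iff]
      exact ⟨by omega, congrArg _ h⟩
    · simp only [Sum.inr.injEq, Prod.mk.injEq, Fin.mk.injEq] at h
      simp only [Sum.inr.injEq, Prod.mk.injEq, Fin.ext_iff]
      exact ⟨by omega, congrArg _ h.2⟩

/-- `oldestFirstFun` as a permutation. -/
def oldestFirst (d p : ℕ) [NeZero p] : Fin d ⊕ Fin p × Fin d ≃ Fin d ⊕ Fin p × Fin d :=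
  Equiv.ofBijective _ (Finite.injective_iff_bijective.1 oldestFirstFun_injective)

/-- Stationarity at the level of covariances. Off the first block row and column, the Lyapunov
equation says that entries depend only on the lag (`h1`); in the first row it gives the
autocovariances with the next observation (`h0`). -/
theorem sigmaSucc_submatrix_oldestFirst (hA : Stable A) (hΩ : Ω.PosDef) :
    ((sigmaSucc A Ω).submatrix (oldestFirst d p) (oldestFirst d p)).toBlocks₂₂ = sigmaP A Ω := by
  have hS := sigmaP_isSymm hA (Ω := Ω) (transpose_eq_of_posDef hΩ)
  have h0 : ∀ a i (hi : i + 1 < p) b,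
      sigmaP A Ω (0, a) (⟨i + 1, hi⟩, b) = sigmaOneP A Ω a (⟨i, by omega⟩, b) := by
    intro a i hi b
    rw [sigmaP_lyapunov hA, Matrix.add_apply, mul_companion_transpose_succ, companion_mul_zero]
    simp [bigOmega, sigmaOneP]
  have h1 : ∀ i (hi : i + 1 < p) a j (hj : j + 1 < p) b,
      sigmaP A Ω (⟨i + 1, hi⟩, a) (⟨j + 1, hj⟩, b)
        = sigmaP A Ω (⟨i, by omega⟩, a) (⟨j, by omega⟩, b) := by
    intro i hi a j hj b
    conv_lhs => rw [sigmaP_lyapunov hA]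
    rw [Matrix.add_apply, mul_companion_transpose_succ, companion_mul_succ]
    simp [bigOmega]
  ext ⟨⟨i, hi⟩, a⟩ ⟨⟨j, hj⟩, b⟩
  simp only [toBlocks₂₂, Matrix.of_apply, submatrix_apply, oldestFirst, Equiv.ofBijective_apply,
    oldestFirstFun]
  rcases i with - | i <;> rcases j with - | j
  · simp [sigmaSucc, sigmaOne]
  · simp only [if_true, Nat.add_eq_zero_iff, one_ne_zero, and_false, if_false, sigmaSucc,
      fromBlocks_apply₁₂, Nat.add_sub_cancel]
    exact (h0 a j hj b).symm
  · simp only [if_true, Nat.add_eq_zero_iff, one_ne_zero, and_false, if_false, sigmaSucc,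
      fromBlocks_apply₂₁, Nat.add_sub_cancel, transpose_apply]
    exact (h0 b i hi a).symm.trans (congrFun (congrFun hS (⟨i + 1, hi⟩, a)) (0, b))
  · simp only [Nat.add_eq_zero_iff, one_ne_zero, and_false, if_false, sigmaSucc,
      fromBlocks_apply₂₂, Nat.add_sub_cancel]
    exact (h1 i hi a j hj b).symm

/-- Centring works because `mu` is a fixed point of the mean recursion; the inverse defining it
exists by stability at `x = 1`. -/
theorem condMean_eq {p : ℕ} {A : Fin p → Matrix (Fin d) (Fin d) ℝ} (hA : Stable A) (φ₀ : Fin d → ℝ) (v : Fin p × Fin d → ℝ) :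
    condMean φ₀ A v = mu φ₀ A + coeffRow A *ᵥ (v - stackMu φ₀ A) := by
  have hdet : IsUnit (1 - ∑ i, A i).det := by
    rw [isUnit_iff_ne_zero]
    intro h
    apply hA 1 (by simp)
    have h2 := congrArg (fun r : ℝ => (r : ℂ)) h
    have h3 := RingHom.map_det Complex.ofRealHom (1 - ∑ i, A i)
    simp only [Complex.ofRealHom_eq_coe] at h3
    rw [h3] at h2
    rw [Complex.ofReal_zero] at h2
    rw [← h2]
    congr 1
    rw [map_sub, map_one, map_sum]
    simp
    rfl
  have hmu : (1 - ∑ i, A i) *ᵥ mu φ₀ A = φ₀ := by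
    rw [mu, mulVec_mulVec, Matrix.mul_nonsing_inv _ hdet, one_mulVec]
  have hrow : coeffRow A *ᵥ stackMu φ₀ A = (∑ i, A i) *ᵥ mu φ₀ A := by
    ext a
    rw [sum_mulVec, Finset.sum_apply]
    simp [mulVec, dotProduct, coeffRow, stackMu, Fintype.sum_prod_type]
  rw [sub_mulVec, one_mulVec, ← hrow, sub_eq_iff_eq_add] at hmu
  rw [condMean, mulVec_sub, hmu]
  abel

end Covariance

/-! ### The multivariate beta integral. -/

section Normalization

open Real

variable {ι : Type*} [Fintype ι]

theorem lintegral_gaussian_pi {b : ℝ} (hb : 0 < b) :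
    ∫⁻ y : ι → ℝ, ENNReal.ofReal (rexp (-b * (y ⬝ᵥ y)))
      = ENNReal.ofReal ((π / b) ^ (Fintype.card ι / 2 : ℝ)) := by
  have h1 : ∀ y : ι → ℝ, rexp (-b * (y ⬝ᵥ y)) = ∏ i, rexp (-b * y i ^ 2) := fun y => by
    rw [← Real.exp_sum, dotProduct, Finset.mul_sum]
    simp only [sq]
  have hI : ∫ y : ι → ℝ, rexp (-b * (y ⬝ᵥ y)) = (π / b) ^ (Fintype.card ι / 2 : ℝ) := by
    simp_rw [h1]
    rw [integral_fintype_prod_volume_eq_pow (fun x : ℝ => rexp (-b * x ^ 2)), integral_gaussian,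
      Real.sqrt_eq_rpow, ← Real.rpow_natCast, ← Real.rpow_mul (by positivity)]
    congr 1
    ring
  rw [← hI, ofReal_integral_eq_lintegral_ofReal]
  -- Integrability comes for free: the Bochner integral of a non-integrable function would be zero.
  · exact .of_integral_ne_zero (by rw [hI]; positivity)
  · exact ae_of_all _ fun y => (Real.exp_pos _).le

theorem lintegral_rpow_mul_exp_neg {a r : ℝ} (ha : 0 < a) (hr : 0 < r) :
    ∫⁻ t in Set.Ioi (0 : ℝ), ENNReal.ofReal (t ^ (a - 1) * rexp (-(r * t)))
      = ENNReal.ofReal ((1 / r) ^ a * Gamma a) := by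
  have hI := Real.integral_rpow_mul_exp_neg_mul_Ioi ha hr
  rw [← hI, ofReal_integral_eq_lintegral_ofReal]
  · refine .of_integral_ne_zero ?_
    rw [hI]
    have := Real.Gamma_pos_of_pos ha
    positivity
  · filter_upwards [ae_restrict_mem measurableSet_Ioi] with t ht
    have : 0 < t := ht
    positivity

theorem dotProduct_self_nonneg (y : ι → ℝ) : 0 ≤ y ⬝ᵥ y :=
  Finset.sum_nonneg fun i _ => mul_self_nonneg (y i)

/-- The multivariate beta integral, via a Gamma mixture of Gaussians. -/
theorem lintegral_one_add_dotProduct_rpow {c α : ℝ} (hc : 0 < c)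
    (hα : (Fintype.card ι / 2 : ℝ) < α) :
    ∫⁻ y : ι → ℝ, ENNReal.ofReal ((1 + (y ⬝ᵥ y) / c) ^ (-α))
      = ENNReal.ofReal ((π * c) ^ (Fintype.card ι / 2 : ℝ) * Gamma (α - Fintype.card ι / 2)
          / Gamma α) := by
  have hα0 : 0 < α := lt_of_le_of_lt (by positivity) hα
  have hG := Real.Gamma_pos_of_pos hα0
  -- The Gamma integral with rate `1 + y ⬝ᵥ y / c` writes the power as a mixture of Gaussians;
  -- Tonelli then lets the Gaussian integral be done first.
  have hin : ∀ y : ι → ℝ, ENNReal.ofReal ((1 + (y ⬝ᵥ y) / c) ^ (-α)) * ENNReal.ofReal (Gamma α)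
      = ∫⁻ t in Set.Ioi (0 : ℝ), ENNReal.ofReal (t ^ (α - 1) * rexp (-t)) *
          ENNReal.ofReal (rexp (-(t / c) * (y ⬝ᵥ y))) := by
    intro y
    have h1 : 0 < 1 + (y ⬝ᵥ y) / c := by
      have := dotProduct_self_nonneg y
      positivity
    rw [← ENNReal.ofReal_mul (by positivity), Real.rpow_neg h1.le, ← Real.inv_rpow h1.le,
      ← one_div, ← lintegral_rpow_mul_exp_neg hα0 h1]
    refine setLIntegral_congr_fun measurableSet_Ioi fun t ht => ?_
    have ht' : 0 < t := ht
    rw [← ENNReal.ofReal_mul (by positivity), mul_assoc, ← Real.exp_add]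
    congr 3
    field_simp
    ring
  have hmul : (∫⁻ y : ι → ℝ, ENNReal.ofReal ((1 + (y ⬝ᵥ y) / c) ^ (-α)))
        * ENNReal.ofReal (Gamma α)
      = ENNReal.ofReal ((π * c) ^ (Fintype.card ι / 2 : ℝ) * Gamma (α - Fintype.card ι / 2)) := by
    rw [← lintegral_mul_const' _ _ ENNReal.ofReal_ne_top]
    simp_rw [hin]
    rw [lintegral_lintegral_swap (by unfold dotProduct; fun_prop)]
    have hs : ∀ t ∈ Set.Ioi (0 : ℝ), ∫⁻ y : ι → ℝ, ENNReal.ofReal (t ^ (α - 1) * rexp (-t)) *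
          ENNReal.ofReal (rexp (-(t / c) * (y ⬝ᵥ y)))
        = ENNReal.ofReal ((π * c) ^ (Fintype.card ι / 2 : ℝ)) *
          ENNReal.ofReal (t ^ (α - Fintype.card ι / 2 - 1) * rexp (-(1 * t))) := by
      intro t ht
      have ht' : 0 < t := ht
      rw [lintegral_const_mul' _ _ ENNReal.ofReal_ne_top, lintegral_gaussian_pi (by positivity),
        ← ENNReal.ofReal_mul (by positivity), ← ENNReal.ofReal_mul (by positivity)]
      congr 1
      rw [div_div_eq_mul_div, Real.div_rpow (by positivity) ht'.le, one_mul,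
        show α - Fintype.card ι / 2 - 1 = (α - 1) - Fintype.card ι / 2 by ring,
        Real.rpow_sub ht' (α - 1)]
      ring
    rw [setLIntegral_congr_fun measurableSet_Ioi hs,
      lintegral_const_mul' _ _ ENNReal.ofReal_ne_top,
      lintegral_rpow_mul_exp_neg (by linarith) one_pos, ← ENNReal.ofReal_mul (by positivity)]
    simp
  rw [ENNReal.ofReal_div_of_pos hG, ← hmul, ENNReal.mul_div_cancel_right]
  · simpa using hG
  · exact ENNReal.ofReal_ne_top

end Normalization

/-! ### The t density and invertible affine maps. -/

section Density

variable {ι : Type*} [Fintype ι] [DecidableEq ι]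

open Real

theorem dotProduct_inv_nonneg {S : Matrix ι ι ℝ} (hS : S.PosDef) (y : ι → ℝ) :
    0 ≤ y ⬝ᵥ (S⁻¹ *ᵥ y) := by
  simpa using hS.inv.posSemidef.dotProduct_mulVec_nonneg y

/-- The `t` density in exponential form. -/
theorem studentTPDF_eq_exp {m : ι → ℝ} {S : Matrix ι ι ℝ} {ν : ℝ} (hS : S.PosDef) (hν : 2 < ν)
    (y : ι → ℝ) :
    studentTPDF m S ν y = Gamma ((Fintype.card ι + ν) / 2) / Gamma (ν / 2) *
      rexp (-(Fintype.card ι / 2) * log π - log S.det / 2 + ν / 2 * log (ν - 2)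
        - (Fintype.card ι + ν) / 2 * log (ν - 2 + (y - m) ⬝ᵥ (S⁻¹ *ᵥ (y - m)))) := by
  have hq := dotProduct_inv_nonneg hS (y - m)
  set q := (y - m) ⬝ᵥ (S⁻¹ *ᵥ (y - m))
  have hc : 0 < ν - 2 := by linarith
  have hd : 0 < S.det := hS.det_pos
  have h1 : 1 + q / (ν - 2) = (ν - 2 + q) / (ν - 2) := by field_simp
  have hsq : √(π ^ Fintype.card ι * (ν - 2) ^ Fintype.card ι)
      = rexp (Fintype.card ι / 2 * log π + Fintype.card ι / 2 * log (ν - 2)) := by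
    rw [Real.sqrt_eq_rpow, Real.rpow_def_of_pos (by positivity),
      Real.log_mul (by positivity) (by positivity), Real.log_pow, Real.log_pow]
    congr 1
    ring
  -- With all powers in one exponential, later identities between t densities become linear
  -- identities between logarithms.
  rw [studentTPDF, h1, hsq, Real.rpow_def_of_pos hd, Real.rpow_def_of_pos (by positivity),
    Real.log_div (by positivity) hc.ne']
  have h2 : ∀ G g a b e : ℝ, G / (rexp a * g) * rexp b * rexp e = G / g * rexp (-a + b + e) := by
    intro G g a b e
    rw [Real.exp_add, Real.exp_add, Real.exp_neg]
    have := (Real.exp_pos a).ne'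
    field_simp
  rw [h2]
  congr 2
  ring

theorem studentTPDF_nonneg {m : ι → ℝ} {S : Matrix ι ι ℝ} {ν : ℝ} (hS : S.PosDef) (hν : 2 < ν)
    (y : ι → ℝ) : 0 ≤ studentTPDF m S ν y := by
  rw [studentTPDF_eq_exp hS hν]
  have h1 := Real.Gamma_pos_of_pos (show 0 < (Fintype.card ι + ν) / 2 by positivity)
  have h2 := Real.Gamma_pos_of_pos (show 0 < ν / 2 by positivity)
  positivity

theorem measurable_studentTPDF (m : ι → ℝ) (S : Matrix ι ι ℝ) (ν : ℝ) :
    Measurable (studentTPDF m S ν) := by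
  unfold studentTPDF
  have : Continuous fun y : ι → ℝ => (y - m) ⬝ᵥ (S⁻¹ *ᵥ (y - m)) := by fun_prop
  have := this.measurable
  fun_prop

theorem lintegral_studentT (m : ι → ℝ) (S : Matrix ι ι ℝ) (ν : ℝ) {f : (ι → ℝ) → ENNReal}
    (hf : Measurable f) :
    ∫⁻ y, f y ∂studentT m S ν = ∫⁻ y, ENNReal.ofReal (studentTPDF m S ν y) * f y := by
  rw [studentT, lintegral_withDensity_eq_lintegral_mul _
    (measurable_studentTPDF m S ν).ennreal_ofReal hf]
  rfl

theorem studentTPDF_affine {m : ι → ℝ} {S : Matrix ι ι ℝ} {ν : ℝ} (hS : S.PosDef) (hν : 2 < ν)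
    (b : ι → ℝ) {L : Matrix ι ι ℝ} (hL : L.det ≠ 0) (y : ι → ℝ) :
    studentTPDF m S ν y = |L.det| * studentTPDF (b + L *ᵥ m) (L * S * Lᵀ) ν (b + L *ᵥ y) := by
  have hu : IsUnit L := (Matrix.isUnit_iff_isUnit_det L).2 (isUnit_iff_ne_zero.2 hL)
  have hS' : (L * S * Lᵀ).PosDef := by
    rwa [← conjTranspose_eq_transpose_of_trivial, ← star_eq_conjTranspose,
      Matrix.IsUnit.posDef_star_right_conjugate_iff hu]
  have hq : (b + L *ᵥ y - (b + L *ᵥ m)) ⬝ᵥ ((L * S * Lᵀ)⁻¹ *ᵥ (b + L *ᵥ y - (b + L *ᵥ m)))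
      = (y - m) ⬝ᵥ (S⁻¹ *ᵥ (y - m)) := by
    rw [add_sub_add_left_eq_sub, ← mulVec_sub, Matrix.mul_inv_rev, Matrix.mul_inv_rev,
      ← transpose_nonsing_inv, ← mulVec_mulVec, dotProduct_mulVec, vecMul_transpose,
      mulVec_mulVec, mulVec_mulVec,
      Matrix.nonsing_inv_mul _ (isUnit_iff_ne_zero.2 hL), one_mulVec, Matrix.mul_assoc,
      Matrix.nonsing_inv_mul _ (isUnit_iff_ne_zero.2 hL), Matrix.mul_one]
  have hdet : log (L * S * Lᵀ).det = 2 * log |L.det| + log S.det := by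
    rw [det_mul, det_mul, det_transpose, mul_right_comm, ← sq, ← sq_abs,
      Real.log_mul (by positivity) hS.det_pos.ne', Real.log_pow]
    norm_num
  rw [studentTPDF_eq_exp hS hν, studentTPDF_eq_exp hS' hν, hq, hdet]
  have habs : |L.det| = rexp (log |L.det|) := (Real.exp_log (abs_pos.2 hL)).symm
  conv_rhs => rw [habs]
  rw [mul_left_comm, ← Real.exp_add]
  congr 2
  rw [Real.log_exp]
  ring

/-- Invertible affine images of `t` distributions. -/
theorem studentT_map_affine {m : ι → ℝ} {S : Matrix ι ι ℝ} {ν : ℝ} (hS : S.PosDef) (hν : 2 < ν)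
    (b : ι → ℝ) {L : Matrix ι ι ℝ} (hL : L.det ≠ 0) :
    (studentT m S ν).map (fun y => b + L *ᵥ y) = studentT (b + L *ᵥ m) (L * S * Lᵀ) ν := by
  have hc : Continuous fun y : ι → ℝ => L *ᵥ y := by fun_prop
  have hT : Measurable fun y : ι → ℝ => b + L *ᵥ y := (continuous_const.add hc).measurable
  -- The Jacobian factor of Lebesgue measure cancels the factor `|L.det|` in `studentTPDF_affine`.
  have hvol : (volume : Measure (ι → ℝ)).map (fun y => b + L *ᵥ y)
      = ENNReal.ofReal |L.det⁻¹| • volume := by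
    have h1 := Real.map_matrix_volume_pi_eq_smul_volume_pi hL
    have h2 : (fun y : ι → ℝ => b + L *ᵥ y) = (fun y => b + y) ∘ (toLin' L) := by
      ext y; simp
    rw [h2, ← Measure.map_map (measurable_const_add b) (by exact hc.measurable), h1,
      Measure.map_smul, map_add_left_eq_self]
  have hL' : 0 < |L.det| := abs_pos.2 hL
  refine Measure.ext_of_lintegral _ fun f hf => ?_
  have hg : Measurable fun y => ENNReal.ofReal (studentTPDF (b + L *ᵥ m) (L * S * Lᵀ) ν y) * f y :=
    (measurable_studentTPDF _ _ _).ennreal_ofReal.mul hf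
  rw [lintegral_map hf hT,
    lintegral_studentT m S ν (f := fun y => f (b + L *ᵥ y)) (hf.comp hT), lintegral_studentT _ _ _ hf]
  have h3 := lintegral_map hg hT (μ := volume)
  rw [hvol, lintegral_smul_measure] at h3
  calc ∫⁻ y, ENNReal.ofReal (studentTPDF m S ν y) * f (b + L *ᵥ y)
      = ENNReal.ofReal |L.det| * ∫⁻ y, ENNReal.ofReal
          (studentTPDF (b + L *ᵥ m) (L * S * Lᵀ) ν (b + L *ᵥ y)) * f (b + L *ᵥ y) := by
        rw [← lintegral_const_mul' _ _ ENNReal.ofReal_ne_top]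
        refine lintegral_congr fun y => ?_
        rw [studentTPDF_affine hS hν b hL y, ENNReal.ofReal_mul hL'.le, mul_assoc]
    _ = _ := by
        rw [← h3, smul_eq_mul, ← mul_assoc, ← ENNReal.ofReal_mul hL'.le, abs_inv,
          mul_inv_cancel₀ hL'.ne', ENNReal.ofReal_one, one_mul]

end Density

/-! ### Total mass, mean and covariance of t laws. -/

section Moments

open Real

variable {ι : Type*} [Fintype ι] [DecidableEq ι] {ν : ℝ}

theorem studentTPDF_zero_one (hν : 2 < ν) (y : ι → ℝ) :
    studentTPDF 0 1 ν y = Gamma ((Fintype.card ι + ν) / 2) /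
      ((π * (ν - 2)) ^ (Fintype.card ι / 2 : ℝ) * Gamma (ν / 2)) *
      (1 + (y ⬝ᵥ y) / (ν - 2)) ^ (-((Fintype.card ι + ν) / 2)) := by
  have hc : 0 < ν - 2 := by linarith
  have h : √(π ^ Fintype.card ι * (ν - 2) ^ Fintype.card ι)
      = (π * (ν - 2)) ^ (Fintype.card ι / 2 : ℝ) := by
    rw [← mul_pow, Real.sqrt_eq_rpow, ← Real.rpow_natCast, ← Real.rpow_mul (by positivity)]
    congr 1
    ring
  rw [studentTPDF, h]
  simp

theorem isProbabilityMeasure_studentT_zero_one (hν : 2 < ν) :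
    IsProbabilityMeasure (studentT (0 : ι → ℝ) 1 ν) := by
  have hc : 0 < ν - 2 := by linarith
  have h1 := Real.Gamma_pos_of_pos (show 0 < (Fintype.card ι + ν) / 2 by positivity)
  have h2 := Real.Gamma_pos_of_pos (show 0 < ν / 2 by positivity)
  constructor
  rw [← setLIntegral_one, Measure.restrict_univ, lintegral_studentT _ _ _ measurable_const]
  simp_rw [mul_one, studentTPDF_zero_one hν]
  have h3 : ∀ y : ι → ℝ, 0 ≤ (1 + (y ⬝ᵥ y) / (ν - 2)) := fun y => by
    have := dotProduct_self_nonneg y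
    positivity
  simp_rw [ENNReal.ofReal_mul (show 0 ≤ Gamma ((Fintype.card ι + ν) / 2) /
      ((π * (ν - 2)) ^ (Fintype.card ι / 2 : ℝ) * Gamma (ν / 2)) by positivity)]
  rw [lintegral_const_mul' _ _ ENNReal.ofReal_ne_top,
    lintegral_one_add_dotProduct_rpow hc (by linarith), ← ENNReal.ofReal_mul (by positivity),
    show ((Fintype.card ι + ν) / 2 - Fintype.card ι / 2 : ℝ) = ν / 2 by ring, ← ENNReal.ofReal_one]
  congr 1
  field_simp

/-- Adding the constant `ν - 2` to the integrand makes it proportional to `1 + y ⬝ᵥ y / (ν - 2)`,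
which raises the exponent of the density by one: again a beta integral, convergent because `ν > 2`.
The constant is cancelled at the end. -/
theorem lintegral_dotProduct_self_studentT (hν : 2 < ν) :
    ∫⁻ y, ENNReal.ofReal (y ⬝ᵥ y) ∂studentT (0 : ι → ℝ) 1 ν
      = ENNReal.ofReal (Fintype.card ι) := by
  have hc : 0 < ν - 2 := by linarith
  have hprob := isProbabilityMeasure_studentT_zero_one (ι := ι) hν
  have h1 := Real.Gamma_pos_of_pos (show 0 < (Fintype.card ι + ν) / 2 - 1 by
    have : (0 : ℝ) ≤ Fintype.card ι := by positivity
    linarith)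
  have h2 := Real.Gamma_pos_of_pos (show 0 < ν / 2 - 1 by linarith)
  have e1 : Gamma ((Fintype.card ι + ν) / 2)
      = ((Fintype.card ι + ν) / 2 - 1) * Gamma ((Fintype.card ι + ν) / 2 - 1) := by
    rw [← Real.Gamma_add_one (by have : (0 : ℝ) ≤ Fintype.card ι := by positivity
                                 linarith)]
    congr 1; ring
  have e2 : Gamma (ν / 2) = (ν / 2 - 1) * Gamma (ν / 2 - 1) := by
    rw [← Real.Gamma_add_one (by linarith)]
    congr 1; ring
  have hm : Measurable fun y : ι → ℝ => y ⬝ᵥ y := by unfold dotProduct; fun_prop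
  have key : (∫⁻ y, ENNReal.ofReal (y ⬝ᵥ y) ∂studentT (0 : ι → ℝ) 1 ν) + ENNReal.ofReal (ν - 2)
      = ENNReal.ofReal (Fintype.card ι) + ENNReal.ofReal (ν - 2) := by
    have h3 : ENNReal.ofReal (ν - 2)
        = ∫⁻ y, ENNReal.ofReal (ν - 2) ∂studentT (0 : ι → ℝ) 1 ν := by simp
    conv_lhs => rw [h3]
    rw [← lintegral_add_left hm.ennreal_ofReal,
      lintegral_studentT _ _ _ (f := fun y => ENNReal.ofReal (y ⬝ᵥ y) + ENNReal.ofReal (ν - 2))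
        (hm.ennreal_ofReal.add measurable_const)]
    have h4 : ∀ y : ι → ℝ, ENNReal.ofReal (studentTPDF 0 1 ν y) *
        (ENNReal.ofReal (y ⬝ᵥ y) + ENNReal.ofReal (ν - 2))
        = ENNReal.ofReal (Gamma ((Fintype.card ι + ν) / 2) /
          ((π * (ν - 2)) ^ (Fintype.card ι / 2 : ℝ) * Gamma (ν / 2)) * (ν - 2)) *
          ENNReal.ofReal ((1 + (y ⬝ᵥ y) / (ν - 2)) ^ (-((Fintype.card ι + ν) / 2 - 1))) := by
      intro y
      have hy := dotProduct_self_nonneg y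
      rw [← ENNReal.ofReal_add hy hc.le,
        ← ENNReal.ofReal_mul (studentTPDF_nonneg PosDef.one hν y), studentTPDF_zero_one hν,
        ← ENNReal.ofReal_mul (by rw [e1, e2]; have : (0 : ℝ) ≤ Fintype.card ι := by positivity
                                 have h5 : 0 < (Fintype.card ι + ν) / 2 - 1 := by linarith
                                 have h6 : 0 < ν / 2 - 1 := by linarith
                                 positivity),
        neg_sub, sub_eq_add_neg (1 : ℝ), Real.rpow_add (by positivity), Real.rpow_one]
      congr 1
      field_simp
      ring
    simp_rw [h4]
    rw [lintegral_const_mul' _ _ ENNReal.ofReal_ne_top,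
      lintegral_one_add_dotProduct_rpow hc (by linarith), ← ENNReal.ofReal_mul,
      show ((Fintype.card ι + ν) / 2 - 1 - Fintype.card ι / 2 : ℝ) = ν / 2 - 1 by ring,
      ← ENNReal.ofReal_add (by positivity) hc.le, e1, e2]
    · congr 1
      have h6 : ν / 2 - 1 ≠ 0 := by linarith
      generalize Gamma ((Fintype.card ι + ν) / 2 - 1) = G at h1 ⊢
      generalize Gamma (ν / 2 - 1) = G' at h2 ⊢
      field_simp
      ring
    · have : (0 : ℝ) ≤ Fintype.card ι := by positivity
      have h5 : 0 < (Fintype.card ι + ν) / 2 - 1 := by linarith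
      have h6 : 0 < ν / 2 - 1 := by linarith
      rw [e1, e2]
      positivity
  exact (ENNReal.add_left_inj ENNReal.ofReal_ne_top).1 key

theorem studentT_zero_one_map_orthogonal (hν : 2 < ν) {L : Matrix ι ι ℝ} (hL : L * Lᵀ = 1) :
    (studentT 0 1 ν).map (fun y => L *ᵥ y) = studentT 0 1 ν := by
  have hd : L.det ≠ 0 := (Matrix.isUnit_det_of_right_inverse hL).ne_zero
  have h := studentT_map_affine (m := 0) (S := 1) PosDef.one hν 0 hd
  simpa [hL] using h

/-- Relabelling the coordinates of a `t` distribution. -/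
theorem studentT_map_comp_equiv {m : ι → ℝ} {S : Matrix ι ι ℝ} (hS : S.PosDef) (hν : 2 < ν)
    (e : ι ≃ ι) :
    (studentT m S ν).map (fun y => y ∘ e) = studentT (m ∘ e) (S.submatrix e e) ν := by
  set L : Matrix ι ι ℝ := (1 : Matrix ι ι ℝ).submatrix e id
  have hL : ∀ y : ι → ℝ, L *ᵥ y = y ∘ e := fun y => by
    ext i
    simp [L, mulVec, dotProduct, Matrix.one_apply]
  have hLS : ∀ M : Matrix ι ι ℝ, L * M * Lᵀ = M.submatrix e e := fun M => by
    ext i j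
    simp [L, Matrix.mul_apply, Matrix.one_apply]
  have hd : L.det ≠ 0 := by
    have h1 : L * Lᵀ = 1 := by
      have := hLS 1
      rwa [Matrix.mul_one, submatrix_one_equiv] at this
    exact (Matrix.isUnit_det_of_right_inverse h1).ne_zero
  have h := studentT_map_affine hS hν 0 hd (m := m)
  simpa [hL, hLS] using h

theorem integral_comp_orthogonal (hν : 2 < ν) {L : Matrix ι ι ℝ} (hL : L * Lᵀ = 1)
    {f : (ι → ℝ) → ℝ} (hf : Measurable f) :
    ∫ y, f (L *ᵥ y) ∂studentT 0 1 ν = ∫ y, f y ∂studentT 0 1 ν := by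
  have hc : Continuous fun y : ι → ℝ => L *ᵥ y := by fun_prop
  conv_rhs => rw [← studentT_zero_one_map_orthogonal hν hL]
  rw [integral_map hc.measurable.aemeasurable hf.aestronglyMeasurable]

theorem integrable_dotProduct_self_studentT (hν : 2 < ν) :
    Integrable (fun y : ι → ℝ => y ⬝ᵥ y) (studentT 0 1 ν) := by
  have hm : Measurable fun y : ι → ℝ => y ⬝ᵥ y := by unfold dotProduct; fun_prop
  refine ⟨hm.aestronglyMeasurable, ?_⟩
  rw [hasFiniteIntegral_iff_ofReal (ae_of_all _ dotProduct_self_nonneg),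
    lintegral_dotProduct_self_studentT hν]
  exact ENNReal.ofReal_lt_top

theorem memLp_studentT_zero_one (hν : 2 < ν) (a : ι) :
    MemLp (fun y : ι → ℝ => y a) 2 (studentT 0 1 ν) := by
  have hm : Measurable fun y : ι → ℝ => y a := measurable_pi_apply a
  rw [memLp_two_iff_integrable_sq hm.aestronglyMeasurable]
  refine (integrable_dotProduct_self_studentT hν).mono' (hm.pow_const 2).aestronglyMeasurable
    (ae_of_all _ fun y => ?_)
  rw [Real.norm_of_nonneg (sq_nonneg _), sq]
  exact Finset.single_le_sum (f := fun i => y i * y i) (fun i _ => mul_self_nonneg _)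
    (Finset.mem_univ a)

/-- Diagonal: swapping coordinates shows all second moments equal, and they sum to the dimension.
Off the diagonal: flipping the sign of one coordinate preserves the law and negates the integral. -/
theorem integral_mul_studentT_zero_one (hν : 2 < ν) (a b : ι) :
    ∫ y : ι → ℝ, y a * y b ∂studentT 0 1 ν = (1 : Matrix ι ι ℝ) a b := by
  rcases eq_or_ne a b with rfl | hab
  · have hswap : ∀ i j : ι, ∫ y : ι → ℝ, y i * y i ∂studentT 0 1 ν
        = ∫ y : ι → ℝ, y j * y j ∂studentT 0 1 ν := by
      intro i j
      have h := studentT_map_comp_equiv (m := 0) (S := (1 : Matrix ι ι ℝ)) PosDef.one hν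
        (Equiv.swap i j)
      rw [submatrix_one_equiv] at h
      change _ = studentT 0 1 ν at h
      conv_lhs => rw [← h]
      have hme : Measurable fun y : ι → ℝ => y ∘ Equiv.swap i j :=
        measurable_pi_lambda _ fun _ => measurable_pi_apply _
      rw [integral_map hme.aemeasurable
        (by exact ((measurable_pi_apply i).mul (measurable_pi_apply i)).aestronglyMeasurable)]
      simp
    have hsum : ∑ i : ι, ∫ y : ι → ℝ, y i * y i ∂studentT 0 1 ν = Fintype.card ι := by
      rw [← integral_finsetSum]
      · have h1 := integral_eq_lintegral_of_nonneg_ae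
          (ae_of_all (studentT (0 : ι → ℝ) 1 ν) dotProduct_self_nonneg)
          (integrable_dotProduct_self_studentT hν).1
        rw [lintegral_dotProduct_self_studentT hν, ENNReal.toReal_ofReal (by positivity)] at h1
        exact h1
      · intro i _
        exact (memLp_studentT_zero_one hν i).integrable_mul (memLp_studentT_zero_one hν i)
    rw [Finset.sum_congr rfl fun i _ => hswap i a, Finset.sum_const, nsmul_eq_mul,
      Finset.card_univ] at hsum
    have hne : (Fintype.card ι : ℝ) ≠ 0 := by
      have : Nonempty ι := ⟨a⟩
      positivity
    rw [Matrix.one_apply_eq]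
    exact mul_left_cancel₀ hne (by rw [hsum, mul_one])
  · have hL : diagonal (fun i => if i = a then (-1 : ℝ) else 1)
        * (diagonal (fun i => if i = a then (-1 : ℝ) else 1))ᵀ = 1 := by
      rw [diagonal_transpose, diagonal_mul_diagonal, ← diagonal_one]
      congr 1
      ext i
      split_ifs <;> simp
    have h := integral_comp_orthogonal hν hL (f := fun y => y a * y b)
      ((measurable_pi_apply a).mul (measurable_pi_apply b))
    simp only [mulVec_diagonal, if_true, if_neg hab.symm, one_mul, neg_mul,
      integral_neg] at h
    rw [Matrix.one_apply_ne hab]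
    linarith

theorem integral_studentT_zero_one (hν : 2 < ν) (a : ι) :
    ∫ y : ι → ℝ, y a ∂studentT 0 1 ν = 0 := by
  have h := integral_comp_orthogonal (ι := ι) hν (L := -1) (by simp) (f := fun y => y a)
    (measurable_pi_apply a)
  simp only [neg_mulVec, one_mulVec, Pi.neg_apply, integral_neg] at h
  linarith

theorem isStudentT_zero_one (hν : 2 < ν) : IsStudentT (studentT (0 : ι → ℝ) 1 ν) 0 1 ν where
  posDef := PosDef.one
  two_lt := hν
  eq_studentT := rfl
  isProbabilityMeasure := isProbabilityMeasure_studentT_zero_one hν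
  memLp := memLp_studentT_zero_one hν
  mean := integral_studentT_zero_one hν
  cov a b := by
    have := isProbabilityMeasure_studentT_zero_one (ι := ι) hν
    rw [covariance_eq_sub (memLp_studentT_zero_one hν a) (memLp_studentT_zero_one hν b),
      integral_studentT_zero_one hν, integral_studentT_zero_one hν, mul_zero, sub_zero]
    exact integral_mul_studentT_zero_one hν a b

theorem sqrt_mul_sqrt_transpose {S : Matrix ι ι ℝ} (hS : S.PosDef) :
    CFC.sqrt S * (CFC.sqrt S)ᵀ = S := by
  have h : (CFC.sqrt S)ᵀ = CFC.sqrt S := by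
    simpa using (CFC.sqrt_nonneg S).posSemidef.isHermitian.eq
  rw [h, CFC.sqrt_mul_sqrt_self S hS.posSemidef.nonneg]

theorem det_sqrt_ne_zero {S : Matrix ι ι ℝ} (hS : S.PosDef) : (CFC.sqrt S).det ≠ 0 := by
  intro h
  have h1 := congrArg det (sqrt_mul_sqrt_transpose hS)
  rw [det_mul, h, zero_mul] at h1
  exact hS.det_pos.ne h1

/-- Every `t` distribution is an affine image of a standard one. -/
theorem studentT_eq_map {m : ι → ℝ} {S : Matrix ι ι ℝ} (hS : S.PosDef) (hν : 2 < ν) :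
    studentT m S ν = (studentT 0 1 ν).map (fun y => m + CFC.sqrt S *ᵥ y) := by
  rw [studentT_map_affine PosDef.one hν m (det_sqrt_ne_zero hS), mulVec_zero, add_zero,
    Matrix.mul_one, sqrt_mul_sqrt_transpose hS]

theorem isStudentT_studentT {m : ι → ℝ} {S : Matrix ι ι ℝ} (hS : S.PosDef) (hν : 2 < ν) :
    IsStudentT (studentT m S ν) m S ν := by
  have hst := isStudentT_zero_one (ι := ι) hν
  have hprob := hst.isProbabilityMeasure
  have hcont : Continuous fun y : ι → ℝ => CFC.sqrt S *ᵥ y := by fun_prop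
  have hT : Measurable fun y : ι → ℝ => m + CFC.sqrt S *ᵥ y :=
    (continuous_const.add hcont).measurable
  have hterm : ∀ a c : ι, MemLp (fun y : ι → ℝ => CFC.sqrt S a c * y c) 2 (studentT 0 1 ν) :=
    fun a c => (hst.memLp c).const_mul _
  have hsum : ∀ a : ι, MemLp (fun y : ι → ℝ => ∑ c, CFC.sqrt S a c * y c) 2 (studentT 0 1 ν) :=
    fun a => memLp_finsetSum _ fun c _ => hterm a c
  have hcoord : ∀ a : ι, MemLp (fun y : ι → ℝ => (m + CFC.sqrt S *ᵥ y) a) 2 (studentT 0 1 ν) :=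
    fun a => (memLp_const (m a)).add (hsum a)
  have hmeas : ∀ a : ι, AEStronglyMeasurable (fun y : ι → ℝ => y a)
      ((studentT 0 1 ν).map (fun y => m + CFC.sqrt S *ᵥ y)) :=
    fun a => (measurable_pi_apply a).aestronglyMeasurable
  refine ⟨hS, hν, rfl, ?_, ?_, ?_, ?_⟩
  · rw [studentT_eq_map hS hν]
    exact Measure.isProbabilityMeasure_map hT.aemeasurable
  · intro a
    rw [studentT_eq_map hS hν, memLp_map_measure_iff (hmeas a) hT.aemeasurable]
    exact hcoord a
  · intro a
    rw [studentT_eq_map hS hν, integral_map hT.aemeasurable (hmeas a)]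
    change ∫ y : ι → ℝ, m a + ∑ c, CFC.sqrt S a c * y c ∂studentT 0 1 ν = m a
    rw [integral_add (integrable_const _) ((hsum a).integrable one_le_two),
      integral_finsetSum _ fun c _ => (hterm a c).integrable one_le_two]
    simp [integral_const_mul, integral_studentT_zero_one hν]
  · intro a b
    rw [studentT_eq_map hS hν, covariance_map (hmeas a) (hmeas b) hT.aemeasurable]
    change cov[fun y : ι → ℝ => m a + ∑ c, CFC.sqrt S a c * y c,
      fun y : ι → ℝ => m b + ∑ c, CFC.sqrt S b c * y c; studentT 0 1 ν] = S a b
    rw [covariance_const_add_left ((hsum a).integrable one_le_two),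
      covariance_const_add_right ((hsum b).integrable one_le_two),
      covariance_fun_sum_fun_sum (hterm a) (hterm b)]
    simp_rw [covariance_const_mul_left, covariance_const_mul_right, hst.cov]
    conv_rhs => rw [← sqrt_mul_sqrt_transpose hS]
    simp [Matrix.mul_apply, Matrix.one_apply]

end Moments

/-! ### Conditioning and marginals for t laws. -/

section Regression

open Real

variable {m n : Type*} [Fintype m] [Fintype n] [DecidableEq m] [DecidableEq n]

theorem inv_smul_of_posDef {C : Matrix m m ℝ} (hC : C.PosDef) {w : ℝ} (hw : w ≠ 0) :
    (w • C)⁻¹ = w⁻¹ • C⁻¹ := by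
  apply Matrix.inv_eq_right_inv
  rw [Matrix.smul_mul, Matrix.mul_smul, smul_smul, mul_inv_cancel₀ hw,
    Matrix.mul_nonsing_inv _ ((Matrix.isUnit_iff_isUnit_det _).1 hC.isUnit), one_smul]

/-- The joint `t` density is the product of the marginal and the conditional densities. -/
theorem studentTPDF_regressionCov {m₁ : m → ℝ} {m₂ : n → ℝ} {B : Matrix m n ℝ}
    {C : Matrix m m ℝ} {D : Matrix n n ℝ} {ν : ℝ} (hC : C.PosDef) (hD : D.PosDef) (hν : 2 < ν)
    (u : m → ℝ) (v : n → ℝ) :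
    studentTPDF (Sum.elim m₁ m₂) (regressionCov B C D) ν (Sum.elim u v)
      = studentTPDF m₂ D ν v * studentTPDF (m₁ + B *ᵥ (v - m₂))
          (((ν - 2 + (v - m₂) ⬝ᵥ (D⁻¹ *ᵥ (v - m₂))) / (ν - 2 + Fintype.card n)) • C)
          (ν + Fintype.card n) u := by
  have hq := dotProduct_inv_nonneg hD (v - m₂)
  have hr := dotProduct_inv_nonneg hC (u - (m₁ + B *ᵥ (v - m₂)))
  have hc : 0 < ν - 2 := by linarith
  have hn : (0 : ℝ) ≤ Fintype.card n := by positivity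
  have hk : (0 : ℝ) ≤ Fintype.card m := by positivity
  set w := (ν - 2 + (v - m₂) ⬝ᵥ (D⁻¹ *ᵥ (v - m₂))) / (ν - 2 + Fintype.card n) with hw
  have hw0 : 0 < w := by positivity
  have hsub : Sum.elim u v - Sum.elim m₁ m₂ = Sum.elim (u - m₁) (v - m₂) := by
    ext (i | i) <;> rfl
  rw [studentTPDF_eq_exp (posDef_regressionCov_iff.2 ⟨hC, hD⟩) hν, studentTPDF_eq_exp hD hν,
    studentTPDF_eq_exp (hC.smul hw0) (by linarith), hsub, dotProduct_inv_regressionCov hC hD,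
    det_regressionCov, inv_smul_of_posDef hC hw0.ne', smul_mulVec, dotProduct_smul, sub_sub u m₁,
    Matrix.det_smul, smul_eq_mul, Real.log_mul hC.det_pos.ne' hD.det_pos.ne',
    Real.log_mul (by positivity) hC.det_pos.ne', Real.log_pow]
  set q := (v - m₂) ⬝ᵥ (D⁻¹ *ᵥ (v - m₂))
  set r := (u - (m₁ + B *ᵥ (v - m₂))) ⬝ᵥ (C⁻¹ *ᵥ (u - (m₁ + B *ᵥ (v - m₂))))
  -- The scale `w` is chosen so that the conditional base is the joint base `ν - 2 + (r + q)` up to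
  -- factors free of `u`.
  have h1 : ν + Fintype.card n - 2 + w⁻¹ * r
      = (ν - 2 + Fintype.card n) * (ν - 2 + (r + q)) / (ν - 2 + q) := by
    rw [hw]
    have : ν - 2 + q ≠ 0 := by positivity
    have : ν - 2 + Fintype.card n ≠ 0 := by positivity
    field_simp
    ring
  have hG1 := Real.Gamma_pos_of_pos (show 0 < (Fintype.card n + ν) / 2 by positivity)
  have hG2 := Real.Gamma_pos_of_pos (show 0 < ν / 2 by positivity)
  rw [h1, hw, Real.log_div (by positivity) (by positivity),
    Real.log_div (by positivity) (by positivity), Real.log_mul (by positivity) (by positivity),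
    Fintype.card_sum, Nat.cast_add, add_comm ν (Fintype.card n : ℝ), ← add_assoc,
    show (Fintype.card n : ℝ) + ν - 2 = ν - 2 + Fintype.card n by ring]
  -- The Gamma factor `b` is shared: numerator of the marginal constant, denominator of the
  -- conditional one.
  have h2 : ∀ a b c x y : ℝ, 0 < b → a / c * rexp (x + y) = b / c * rexp x * (a / b * rexp y) := by
    intro a b c x y hb
    rw [Real.exp_add]
    field_simp
  rw [← h2 _ _ _ _ _ hG1]
  congr 2
  · rw [add_assoc]
  · ring

/-- Integration against a joint `t` distribution, conditioning on the second block. -/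
theorem lintegral_studentT_regressionCov {m₁ : m → ℝ} {m₂ : n → ℝ} {B : Matrix m n ℝ}
    {C : Matrix m m ℝ} {D : Matrix n n ℝ} {ν : ℝ} (hC : C.PosDef) (hD : D.PosDef) (hν : 2 < ν)
    {f : (m ⊕ n → ℝ) → ENNReal} (hf : Measurable f) :
    ∫⁻ y, f y ∂studentT (Sum.elim m₁ m₂) (regressionCov B C D) ν
      = ∫⁻ v, ∫⁻ u, f (Sum.elim u v) ∂studentT (m₁ + B *ᵥ (v - m₂))
          (((ν - 2 + (v - m₂) ⬝ᵥ (D⁻¹ *ᵥ (v - m₂))) / (ν - 2 + Fintype.card n)) • C)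
          (ν + Fintype.card n) ∂studentT m₂ D ν := by
  set e := (MeasurableEquiv.sumPiEquivProdPi (fun _ : m ⊕ n => ℝ)).symm
  have he : ∀ x : (m → ℝ) × (n → ℝ), e x = Sum.elim x.1 x.2 := fun x => by
    ext (i | i) <;> rfl
  have hmp : MeasurePreserving e volume volume :=
    volume_measurePreserving_sumPiEquivProdPi_symm (fun _ : m ⊕ n => ℝ)
  have hg : Measurable fun y => ENNReal.ofReal
      (studentTPDF (Sum.elim m₁ m₂) (regressionCov B C D) ν y) * f y :=
    (measurable_studentTPDF _ _ _).ennreal_ofReal.mul hf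
  rw [lintegral_studentT _ _ _ hf, ← hmp.lintegral_comp hg, Measure.volume_eq_prod,
    lintegral_prod_symm (fun x => ENNReal.ofReal
      (studentTPDF (Sum.elim m₁ m₂) (regressionCov B C D) ν (e x)) * f (e x))
      (hg.comp e.measurable).aemeasurable, studentT.eq_def m₂,
    lintegral_withDensity_eq_lintegral_mul_non_measurable _
      (measurable_studentTPDF m₂ D ν).ennreal_ofReal (ae_of_all _ fun _ => ENNReal.ofReal_lt_top)]
  refine lintegral_congr fun v => ?_
  have hfv : Measurable fun u : m → ℝ => f (Sum.elim u v) := by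
    have h1 : Measurable fun u : m → ℝ => e (u, v) := e.measurable.comp measurable_prodMk_right
    simp_rw [he] at h1
    exact hf.comp h1
  rw [Pi.mul_apply, lintegral_studentT _ _ _ hfv,
    ← lintegral_const_mul' _ _ ENNReal.ofReal_ne_top]
  refine lintegral_congr fun u => ?_
  rw [he, studentTPDF_regressionCov hC hD hν, ENNReal.ofReal_mul (studentTPDF_nonneg hD hν v),
    mul_assoc]

/-- Marginals of a `t` distribution. -/
theorem studentT_map_comp_inr {μ : m ⊕ n → ℝ} {S : Matrix (m ⊕ n) (m ⊕ n) ℝ} {ν : ℝ}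
    (hS : S.PosDef) (hν : 2 < ν) :
    (studentT μ S ν).map (fun y => y ∘ Sum.inr) = studentT (μ ∘ Sum.inr) S.toBlocks₂₂ ν := by
  -- Once the matrix is a regression covariance, the inner integral is that of a constant against a
  -- probability measure.
  obtain ⟨B, C, h, hC, hD⟩ := exists_eq_regressionCov hS
  have hm : Measurable fun y : m ⊕ n → ℝ => y ∘ Sum.inr :=
    measurable_pi_lambda _ fun _ => measurable_pi_apply _
  refine Measure.ext_of_lintegral _ fun f hf => ?_
  rw [lintegral_map hf hm, ← Sum.elim_comp_inl_inr μ]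
  conv_lhs => rw [h]
  rw [lintegral_studentT_regressionCov hC hD hν (f := fun y => f (y ∘ Sum.inr)) (hf.comp hm)]
  refine lintegral_congr fun v => ?_
  have hw : 0 < (ν - 2 + (v - μ ∘ Sum.inr) ⬝ᵥ (S.toBlocks₂₂⁻¹ *ᵥ (v - μ ∘ Sum.inr))) /
      (ν - 2 + Fintype.card n) := by
    have := dotProduct_inv_nonneg hD (v - μ ∘ Sum.inr)
    have : 0 < ν - 2 := by linarith
    positivity
  have := (isStudentT_studentT (m := μ ∘ Sum.inl + B *ᵥ (v - μ ∘ Sum.inr)) (hC.smul hw)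
    (ν := ν + Fintype.card n)
    (by have : (0 : ℝ) ≤ Fintype.card n := by positivity
        linarith)).isProbabilityMeasure
  simp only [Sum.elim_comp_inr, lintegral_const, measure_univ, mul_one]

end Regression

/-! ### Kernels driven by independent noise. -/

section NoiseKernel

variable {E F G : Type*} [MeasurableSpace E] [MeasurableSpace F] [MeasurableSpace G]

/-- The kernel sending `x` to the law of `T (x, e)` with `e ∼ Q`. -/
def noiseKernel (T : E × F → G) (Q : Measure F) : Kernel E G :=
  (Kernel.id ×ₖ Kernel.const E Q).map T

theorem noiseKernel_apply {T : E × F → G} (hT : Measurable T) (Q : Measure F) [SFinite Q] (x : E) :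
    noiseKernel T Q x = Q.map fun e => T (x, e) := by
  rw [noiseKernel, Kernel.map_apply _ hT, Kernel.prod_apply, Kernel.id_apply, Kernel.const_apply,
    Measure.dirac_prod, Measure.map_map hT measurable_prodMk_left]
  rfl

theorem isMarkovKernel_noiseKernel {T : E × F → G} (hT : Measurable T) (Q : Measure F)
    [IsProbabilityMeasure Q] : IsMarkovKernel (noiseKernel T Q) :=
  Kernel.IsMarkovKernel.map _ hT

/-- By independence the pair `(X, ε)` has a product law, so Fubini freezes `X` at `x` and leaves the
law of `T (x, ε)`. -/
theorem hasCondDistrib_noiseKernel {𝒮 : Type*} [MeasurableSpace 𝒮] {P : Measure 𝒮}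
    [IsProbabilityMeasure P] {X : 𝒮 → E} {ε : 𝒮 → F} (hX : Measurable X) (hε : Measurable ε)
    (hind : IndepFun X ε P) {T : E × F → G} (hT : Measurable T) :
    HasCondDistrib (fun ω => T (X ω, ε ω)) X (noiseKernel T (P.map ε)) P := by
  have hp : IsProbabilityMeasure (P.map ε) := Measure.isProbabilityMeasure_map hε.aemeasurable
  have hpX : IsProbabilityMeasure (P.map X) := Measure.isProbabilityMeasure_map hX.aemeasurable
  have hk := isMarkovKernel_noiseKernel hT (P.map ε)
  refine ⟨(hX.prodMk (hT.comp (hX.prodMk hε))).aemeasurable, ?_⟩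
  have hprod := hind.map_prod_eq_prod_map_map hX.aemeasurable hε.aemeasurable
  refine Measure.ext_of_lintegral _ fun f hf => ?_
  have hg : Measurable fun xe : E × F => f (xe.1, T xe) := hf.comp (measurable_fst.prodMk hT)
  have hXT : Measurable fun ω => (X ω, T (X ω, ε ω)) := hX.prodMk (hT.comp (hX.prodMk hε))
  rw [lintegral_map hf hXT, Measure.lintegral_compProd hf]
  calc ∫⁻ ω, f (X ω, T (X ω, ε ω)) ∂P
      = ∫⁻ xe, f (xe.1, T xe) ∂P.map (fun ω => (X ω, ε ω)) :=
        (lintegral_map hg (hX.prodMk hε)).symm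
    _ = ∫⁻ x, ∫⁻ e, f (x, T (x, e)) ∂P.map ε ∂P.map X := by
        rw [hprod, lintegral_prod _ hg.aemeasurable]
    _ = _ := by
        refine lintegral_congr fun x => ?_
        have hx : Measurable fun e => T (x, e) := hT.comp measurable_prodMk_left
        have hfx : Measurable fun y => f (x, y) := hf.comp measurable_prodMk_left
        rw [noiseKernel_apply hT]
        exact (lintegral_map hfx hx).symm

end NoiseKernel

/-! ### The Markov chain generated by a random recursion. -/

section Recursion

variable {E F : Type*} [MeasurableSpace E] [MeasurableSpace F]

/-- The states of the recursion `X_{t+1} = T (X_t, ε_{t+1})`, on the space of sequences of pairs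
whose first entry at time `0` is the initial state and whose second entries are the noise. -/
def recState (T : E × F → E) : ℕ → (ℕ → E × F) → E
  | 0, ω => (ω 0).1
  | t + 1, ω => T (recState T t ω, (ω (t + 1)).2)

/-- The `σ`-algebra of the coordinates before time `t`. -/
abbrev coordsBefore (E F : Type*) [MeasurableSpace E] [MeasurableSpace F] (t : ℕ) :
    MeasurableSpace (ℕ → E × F) :=
  ⨆ i ∈ Set.Iio t, MeasurableSpace.comap (fun ω : ℕ → E × F => ω i) inferInstance

theorem measurable_coordsBefore_eval {i t : ℕ} (h : i < t) :
    Measurable[coordsBefore E F t] fun ω : ℕ → E × F => ω i :=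
  Measurable.mono (comap_measurable _)
    (le_iSup₂_of_le (f := fun j (_ : j ∈ Set.Iio t) =>
      MeasurableSpace.comap (fun ω : ℕ → E × F => ω j) inferInstance) i h le_rfl) le_rfl

theorem coordsBefore_le (t : ℕ) : coordsBefore E F t ≤ MeasurableSpace.pi :=
  iSup₂_le fun i _ => (measurable_pi_apply i).comap_le

/-- The recursion is adapted: the state at time `k` reads no coordinate after `k`. -/
theorem measurable_coordsBefore_recState {T : E × F → E} (hT : Measurable T) {k t : ℕ}
    (h : k < t) : Measurable[coordsBefore E F t] (recState T k) := by
  induction k with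
  | zero => exact measurable_fst.comp (measurable_coordsBefore_eval h)
  | succ k ih =>
    exact hT.comp ((ih (by omega)).prodMk
      (measurable_snd.comp (measurable_coordsBefore_eval h)))

theorem measurable_recState {T : E × F → E} (hT : Measurable T) (t : ℕ) :
    Measurable (recState T t) :=
  (measurable_coordsBefore_recState hT t.lt_succ_self).mono (coordsBefore_le _) le_rfl

variable {R : Measure (E × F)} [IsProbabilityMeasure R]

theorem indep_coordsBefore (t : ℕ) :
    Indep (MeasurableSpace.comap (fun ω : ℕ → E × F => ω t) inferInstance) (coordsBefore E F t)
      (Measure.infinitePi fun _ : ℕ => R) := by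
  have h := iIndepFun_infinitePi (P := fun _ : ℕ => R) (X := fun _ x => x)
    (fun _ => measurable_id)
  have h2 := indep_iSup_of_disjoint (S := {t}) (T := Set.Iio t)
    (fun i => (measurable_pi_apply i).comap_le) h (by simp)
  simpa only [Set.mem_singleton_iff, iSup_iSup_eq_left] using h2

theorem indep_noise_of_le {m : MeasurableSpace (ℕ → E × F)} {t : ℕ} (hm : m ≤ coordsBefore E F t) :
    Indep (MeasurableSpace.comap (fun ω : ℕ → E × F => (ω t).2) inferInstance) m
      (Measure.infinitePi fun _ : ℕ => R) := by
  refine indep_of_indep_of_le_left (indep_of_indep_of_le_right (indep_coordsBefore t) hm) ?_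
  exact (measurable_snd.comp (comap_measurable fun ω : ℕ → E × F => ω t)).comap_le

theorem indepFun_noise {H : Type*} [MeasurableSpace H] {h : (ℕ → E × F) → H} {t : ℕ}
    (hh : Measurable[coordsBefore E F t] h) :
    IndepFun h (fun ω : ℕ → E × F => (ω t).2) (Measure.infinitePi fun _ : ℕ => R) :=
  (indep_noise_of_le hh.comap_le).symm

theorem map_noise (t : ℕ) :
    (Measure.infinitePi fun _ : ℕ => R).map (fun ω : ℕ → E × F => (ω t).2) = R.map Prod.snd := by
  conv_rhs => rw [← Measure.infinitePi_map_eval (fun _ : ℕ => R) t]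
  rw [Measure.map_map measurable_snd (measurable_pi_apply t)]
  rfl

theorem iIndepFun_noise :
    iIndepFun (fun (t : ℕ) (ω : ℕ → E × F) => (ω t).2) (Measure.infinitePi fun _ : ℕ => R) :=
  iIndepFun_infinitePi (P := fun _ : ℕ => R) (X := fun _ x => x.2) (fun _ => measurable_snd)

/-- The noise at time `t + 1` is independent of the entire history up to `t`, and the update reads
only the last entry of that history. -/
theorem isMarkovChain_recState {T : E × F → E} (hT : Measurable T) :
    IsMarkovChain (Measure.infinitePi fun _ : ℕ => R) (recState T)
      (noiseKernel T (R.map Prod.snd)) where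
  measurable := measurable_recState hT
  hasCondDistrib t := by
    have hp : IsProbabilityMeasure (R.map Prod.snd) :=
      Measure.isProbabilityMeasure_map measurable_snd.aemeasurable
    have hH : Measurable[coordsBefore E F (t + 1)]
        fun (ω : ℕ → E × F) (s : Finset.Iic t) => recState T s ω :=
      @measurable_pi_lambda _ _ _ (coordsBefore E F (t + 1)) _ _ fun s =>
        measurable_coordsBefore_recState hT (Nat.lt_succ_of_le (Finset.mem_Iic.1 s.2))
    have hT' : Measurable fun he : (Finset.Iic t → E) × F =>
        T (he.1 ⟨t, Finset.mem_Iic.2 le_rfl⟩, he.2) := by fun_prop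
    have h := hasCondDistrib_noiseKernel (hH.mono (coordsBefore_le _) le_rfl)
      (measurable_snd.comp (measurable_pi_apply (t + 1))) (indepFun_noise (R := R) hH) hT'
    have hk : (noiseKernel T (R.map Prod.snd)).comap
        (fun h : Finset.Iic t → E => h ⟨t, Finset.mem_Iic.2 le_rfl⟩) (measurable_pi_apply _)
        = noiseKernel (fun he : (Finset.Iic t → E) × F =>
          T (he.1 ⟨t, Finset.mem_Iic.2 le_rfl⟩, he.2)) (R.map Prod.snd) := by
      ext1 x
      rw [Kernel.comap_apply, noiseKernel_apply hT, noiseKernel_apply hT']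
    rw [hk, ← map_noise (t + 1)]
    exact h

/-- The output map `U` is free so that both the next state (`U = T`) and the next observation are
covered. -/
theorem hasCondDistrib_recState {G : Type*} [MeasurableSpace G] {T : E × F → E} (hT : Measurable T)
    {U : E × F → G} (hU : Measurable U) (t : ℕ) :
    HasCondDistrib (fun ω => U (recState T t ω, (ω (t + 1)).2)) (recState T t)
      (noiseKernel U (R.map Prod.snd)) (Measure.infinitePi fun _ : ℕ => R) := by
  rw [← map_noise (t + 1)]
  exact hasCondDistrib_noiseKernel (measurable_recState hT t)
    (measurable_snd.comp (measurable_pi_apply (t + 1)))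
    (indepFun_noise (measurable_coordsBefore_recState hT t.lt_succ_self)) hU

theorem map_recState_zero (T : E × F → E) :
    (Measure.infinitePi fun _ : ℕ => R).map (recState T 0) = R.map Prod.fst := by
  conv_rhs => rw [← Measure.infinitePi_map_eval (fun _ : ℕ => R) 0]
  rw [Measure.map_map measurable_fst (measurable_pi_apply 0)]
  rfl

/-- A chain started in an invariant distribution stays there. -/
theorem map_recState_of_invariant {T : E × F → E} (hT : Measurable T)
    (hinv : Kernel.Invariant (noiseKernel T (R.map Prod.snd)) (R.map Prod.fst)) (t : ℕ) :
    (Measure.infinitePi fun _ : ℕ => R).map (recState T t) = R.map Prod.fst := by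
  have hp : IsProbabilityMeasure (R.map Prod.snd) :=
    Measure.isProbabilityMeasure_map measurable_snd.aemeasurable
  have hp1 : IsProbabilityMeasure (R.map Prod.fst) :=
    Measure.isProbabilityMeasure_map measurable_fst.aemeasurable
  have hk := isMarkovKernel_noiseKernel hT (R.map Prod.snd)
  induction t with
  | zero => exact map_recState_zero T
  | succ t ih =>
    -- The second marginal of the joint law of consecutive states is the image of the current law
    -- under the kernel.
    have h := congrArg Measure.snd (hasCondDistrib_recState (R := R) hT hT t).map_eq
    rw [Measure.snd_map_prodMk (measurable_recState hT t), Measure.snd_compProd, ih] at h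
    exact h.trans hinv

end Recursion

/-! ### The transition of the autoregression and its invariant t law. -/

section Autoregression

variable {d p : ℕ} (φ₀ : Fin d → ℝ) (A : Fin p → Matrix (Fin d) (Fin d) ℝ)
  (Ω : Matrix (Fin d) (Fin d) ℝ) (ν : ℝ)

/-- The next observation, as a function of the `p`-vector of its past and the error. -/
def nextObs (ve : (Fin p × Fin d → ℝ) × (Fin d → ℝ)) : Fin d → ℝ :=
  condMean φ₀ A ve.1 + CFC.sqrt (condCov φ₀ A Ω ν ve.1) *ᵥ ve.2

/-- The `p`-vector that results from `v` when `u` is observed. -/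
def pushObs [NeZero p] (v : Fin p × Fin d → ℝ) (u : Fin d → ℝ) : Fin p × Fin d → ℝ :=
  (Sum.elim u v ∘ oldestFirst d p) ∘ Sum.inr

/-- The next `p`-vector, as a function of the present one and the error. -/
def nextState [NeZero p] (ve : (Fin p × Fin d → ℝ) × (Fin d → ℝ)) : Fin p × Fin d → ℝ :=
  pushObs ve.1 (nextObs φ₀ A Ω ν ve)

theorem pushObs_zero [NeZero p] (v : Fin p × Fin d → ℝ) (u : Fin d → ℝ) (a : Fin d) :
    pushObs v u (0, a) = u a := by
  simp [pushObs, oldestFirst, oldestFirstFun]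

theorem pushObs_succ [NeZero p] (v : Fin p × Fin d → ℝ) (u : Fin d → ℝ) (i : ℕ) (hi : i + 1 < p)
    (a : Fin d) : pushObs v u (⟨i + 1, hi⟩, a) = v (⟨i, by omega⟩, a) := by
  simp [pushObs, oldestFirst, oldestFirstFun]

variable {φ₀ A Ω ν}

theorem condCov_factor_pos [NeZero p] (hA : Stable A) (hΩ : Ω.PosDef) (hν : 2 < ν)
    (v : Fin p × Fin d → ℝ) :
    0 < (ν - 2 + (v - stackMu φ₀ A) ⬝ᵥ ((sigmaP A Ω)⁻¹ *ᵥ (v - stackMu φ₀ A))) /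
      (ν - 2 + (d : ℝ) * (p : ℝ)) := by
  have := dotProduct_inv_nonneg (sigmaP_posDef hA hΩ) (v - stackMu φ₀ A)
  have : 0 < ν - 2 := by linarith
  positivity

theorem condCov_posDef [NeZero p] (hA : Stable A) (hΩ : Ω.PosDef) (hν : 2 < ν)
    (v : Fin p × Fin d → ℝ) : (condCov φ₀ A Ω ν v).PosDef :=
  hΩ.smul (condCov_factor_pos hA hΩ hν v)

/-- Only a scalar depends on `v`, so `nextObs` is visibly continuous and no regularity of the matrix
square root is needed. -/
theorem sqrt_condCov [NeZero p] (hA : Stable A) (hΩ : Ω.PosDef) (hν : 2 < ν)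
    (v : Fin p × Fin d → ℝ) :
    CFC.sqrt (condCov φ₀ A Ω ν v)
      = √((ν - 2 + (v - stackMu φ₀ A) ⬝ᵥ ((sigmaP A Ω)⁻¹ *ᵥ (v - stackMu φ₀ A))) /
          (ν - 2 + (d : ℝ) * (p : ℝ))) • CFC.sqrt Ω := by
  refine CFC.sqrt_unique ?_ ?_
  · rw [Matrix.smul_mul, Matrix.mul_smul, smul_smul,
      Real.mul_self_sqrt (condCov_factor_pos hA hΩ hν v).le,
      CFC.sqrt_mul_sqrt_self Ω hΩ.posSemidef.nonneg]
    rfl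
  · exact ((CFC.sqrt_nonneg Ω).posSemidef.smul (Real.sqrt_nonneg _)).nonneg

theorem measurable_nextObs [NeZero p] (hA : Stable A) (hΩ : Ω.PosDef) (hν : 2 < ν) :
    Measurable (nextObs φ₀ A Ω ν) := by
  have h1 : Continuous fun ve : (Fin p × Fin d → ℝ) × (Fin d → ℝ) => condMean φ₀ A ve.1 := by
    unfold condMean; fun_prop
  have h2 : Continuous fun ve : (Fin p × Fin d → ℝ) × (Fin d → ℝ) =>
      √((ν - 2 + (ve.1 - stackMu φ₀ A) ⬝ᵥ ((sigmaP A Ω)⁻¹ *ᵥ (ve.1 - stackMu φ₀ A))) /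
          (ν - 2 + (d : ℝ) * (p : ℝ))) := by fun_prop
  have h3 : Continuous fun ve : (Fin p × Fin d → ℝ) × (Fin d → ℝ) => CFC.sqrt Ω *ᵥ ve.2 := by
    fun_prop
  have h4 : nextObs φ₀ A Ω ν = fun ve => condMean φ₀ A ve.1 +
      √((ν - 2 + (ve.1 - stackMu φ₀ A) ⬝ᵥ ((sigmaP A Ω)⁻¹ *ᵥ (ve.1 - stackMu φ₀ A))) /
        (ν - 2 + (d : ℝ) * (p : ℝ))) • (CFC.sqrt Ω *ᵥ ve.2) := by
    ext1 ve
    simp only [nextObs, sqrt_condCov hA hΩ hν, smul_mulVec]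
  rw [h4]
  exact (h1.add (h2.smul h3)).measurable

theorem measurable_pushObs [NeZero p] :
    Measurable fun vu : (Fin p × Fin d → ℝ) × (Fin d → ℝ) => pushObs vu.1 vu.2 := by
  refine measurable_pi_lambda _ fun k => ?_
  simp only [pushObs, Function.comp_apply]
  rcases oldestFirst d p (Sum.inr k) with a | a
  · exact (measurable_pi_apply a).comp measurable_snd
  · exact (measurable_pi_apply a).comp measurable_fst

theorem measurable_nextState [NeZero p] (hA : Stable A) (hΩ : Ω.PosDef) (hν : 2 < ν) :
    Measurable (nextState φ₀ A Ω ν) :=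
  measurable_pushObs.comp (measurable_fst.prodMk (measurable_nextObs hA hΩ hν))

variable (d p) in
theorem two_lt_add_mul (hν : 2 < ν) : 2 < ν + (d : ℝ) * (p : ℝ) := by
  have : (0 : ℝ) ≤ (d : ℝ) * (p : ℝ) := by positivity
  linarith

theorem noiseKernel_nextObs [NeZero p] (hA : Stable A) (hΩ : Ω.PosDef) (hν : 2 < ν)
    (v : Fin p × Fin d → ℝ) :
    noiseKernel (nextObs φ₀ A Ω ν) (studentT 0 1 (ν + (d : ℝ) * (p : ℝ))) v
      = studentT (condMean φ₀ A v) (condCov φ₀ A Ω ν v) (ν + (d : ℝ) * (p : ℝ)) := by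
  have := isProbabilityMeasure_studentT_zero_one (ι := Fin d) (two_lt_add_mul d p hν)
  rw [noiseKernel_apply (measurable_nextObs hA hΩ hν),
    studentT_eq_map (condCov_posDef hA hΩ hν v) (two_lt_add_mul d p hν)]
  rfl

theorem measurable_sumElim_swap {m n : Type*} :
    Measurable fun vu : (n → ℝ) × (m → ℝ) => (Sum.elim vu.2 vu.1 : m ⊕ n → ℝ) := by
  refine measurable_pi_lambda _ fun k => ?_
  rcases k with a | a
  · exact (measurable_pi_apply a).comp measurable_snd
  · exact (measurable_pi_apply a).comp measurable_fst

/-- The joint law of `(z_t, 𝐳_{t-1})` under stationarity. -/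
theorem compProd_noiseKernel_nextObs [NeZero p] (hA : Stable A) (hΩ : Ω.PosDef) (hν : 2 < ν) :
    ((studentT (stackMu φ₀ A) (sigmaP A Ω) ν) ⊗ₘ
        noiseKernel (nextObs φ₀ A Ω ν) (studentT 0 1 (ν + (d : ℝ) * (p : ℝ)))).map
        (fun vu => Sum.elim vu.2 vu.1)
      = studentT (stackMuSucc φ₀ A) (sigmaSucc A Ω) ν := by
  have := isProbabilityMeasure_studentT_zero_one (ι := Fin d) (two_lt_add_mul d p hν)
  have hk := isMarkovKernel_noiseKernel (measurable_nextObs (φ₀ := φ₀) hA hΩ hν)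
    (studentT 0 1 (ν + (d : ℝ) * (p : ℝ)))
  have hp := (isStudentT_studentT (m := stackMu φ₀ A) (sigmaP_posDef hA hΩ)
    hν).isProbabilityMeasure
  refine Measure.ext_of_lintegral _ fun f hf => ?_
  rw [lintegral_map hf measurable_sumElim_swap,
    Measure.lintegral_compProd (f := fun vu => f (Sum.elim vu.2 vu.1))
      (hf.comp measurable_sumElim_swap), sigmaSucc_eq_regressionCov hA hΩ, stackMuSucc,
    lintegral_studentT_regressionCov hΩ (sigmaP_posDef hA hΩ) hν hf]
  refine lintegral_congr fun v => ?_
  have hcard : (Fintype.card (Fin p × Fin d) : ℝ) = (d : ℝ) * (p : ℝ) := by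
    simp [mul_comm]
  rw [noiseKernel_nextObs hA hΩ hν, ← condMean_eq hA, hcard]
  rfl

/-- The stationary distribution. -/
theorem invariant_noiseKernel_nextState [NeZero p] (hA : Stable A) (hΩ : Ω.PosDef) (hν : 2 < ν) :
    Kernel.Invariant
      (noiseKernel (nextState φ₀ A Ω ν) (studentT 0 1 (ν + (d : ℝ) * (p : ℝ))))
      (studentT (stackMu φ₀ A) (sigmaP A Ω) ν) := by
  have := isProbabilityMeasure_studentT_zero_one (ι := Fin d) (two_lt_add_mul d p hν)
  have hk := isMarkovKernel_noiseKernel (measurable_nextObs (φ₀ := φ₀) hA hΩ hν)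
    (studentT 0 1 (ν + (d : ℝ) * (p : ℝ)))
  have hp := (isStudentT_studentT (m := stackMu φ₀ A) (sigmaP_posDef hA hΩ)
    hν).isProbabilityMeasure
  have hS := sigmaSucc_posDef hA hΩ
  have hS' : ((sigmaSucc A Ω).submatrix (oldestFirst d p) (oldestFirst d p)).PosDef :=
    hS.submatrix (oldestFirst d p).injective
  have hme : Measurable fun y : Fin d ⊕ Fin p × Fin d → ℝ => y ∘ oldestFirst d p :=
    measurable_pi_lambda _ fun _ => measurable_pi_apply _
  have hmr : Measurable fun y : Fin d ⊕ Fin p × Fin d → ℝ =>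
      (y ∘ Sum.inr : Fin p × Fin d → ℝ) :=
    measurable_pi_lambda _ fun _ => measurable_pi_apply _
  have hmean : (stackMuSucc φ₀ A ∘ oldestFirst d p) ∘ Sum.inr = stackMu φ₀ A := by
    ext ⟨i, a⟩
    simp only [Function.comp_apply, oldestFirst, Equiv.ofBijective_apply, oldestFirstFun]
    split_ifs <;> rfl
  -- The joint law of `p + 1` consecutive observations is relabelled and its oldest entry dropped;
  -- mean and covariance come back unchanged.
  have h1 : (((studentT (stackMu φ₀ A) (sigmaP A Ω) ν) ⊗ₘ
        noiseKernel (nextObs φ₀ A Ω ν) (studentT 0 1 (ν + (d : ℝ) * (p : ℝ)))).map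
        (fun vu => Sum.elim vu.2 vu.1)).map
          (fun y => (y ∘ oldestFirst d p) ∘ Sum.inr) = studentT (stackMu φ₀ A) (sigmaP A Ω) ν := by
    rw [compProd_noiseKernel_nextObs hA hΩ hν]
    have h2 := studentT_map_comp_inr (μ := stackMuSucc φ₀ A ∘ oldestFirst d p) hS' hν
    rw [← studentT_map_comp_equiv hS hν, Measure.map_map hmr hme, hmean,
      sigmaSucc_submatrix_oldestFirst hA hΩ] at h2
    exact h2
  rw [Kernel.Invariant]
  conv_rhs => rw [← h1]
  have hmer : Measurable fun y : Fin d ⊕ Fin p × Fin d → ℝ =>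
      ((y ∘ oldestFirst d p) ∘ Sum.inr : Fin p × Fin d → ℝ) := hmr.comp hme
  rw [Measure.map_map hmer measurable_sumElim_swap]
  -- Both sides integrate `f (pushObs v u)`, with `u` drawn from the conditional law given `v`.
  refine Measure.ext_of_lintegral _ fun f hf => ?_
  rw [Measure.lintegral_bind (Kernel.aemeasurable _) hf.aemeasurable,
    lintegral_map hf (hmer.comp measurable_sumElim_swap),
    Measure.lintegral_compProd (f := fun vu => f (((fun y => (y ∘ oldestFirst d p) ∘ Sum.inr) ∘
      fun vu : (Fin p × Fin d → ℝ) × (Fin d → ℝ) => Sum.elim vu.2 vu.1) vu))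
      (hf.comp (hmer.comp measurable_sumElim_swap))]
  refine lintegral_congr fun v => ?_
  have hpv : Measurable fun u => f (pushObs v u) :=
    hf.comp (measurable_pushObs.comp measurable_prodMk_left)
  have hsv : Measurable fun e => nextState φ₀ A Ω ν (v, e) :=
    (measurable_nextState hA hΩ hν).comp measurable_prodMk_left
  have hnv : Measurable fun e => nextObs φ₀ A Ω ν (v, e) :=
    (measurable_nextObs hA hΩ hν).comp measurable_prodMk_left
  rw [noiseKernel_apply (measurable_nextState hA hΩ hν),
    noiseKernel_apply (measurable_nextObs hA hΩ hν),
    lintegral_map hf hsv]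
  exact (lintegral_map hpv hnv).symm

end Autoregression

/-! ### From states back to observations. -/

section Observations

variable {d p : ℕ} [NeZero p]

/-- The observations whose `p`-vectors are the states `X`, extended by `0` before time `1 - p`. -/
def obsOfStates {𝒮 : Type*} (X : ℕ → 𝒮 → Fin p × Fin d → ℝ) (t : ℤ) (ω : 𝒮) : Fin d → ℝ :=
  if 0 ≤ t then fun a => X t.toNat ω (0, a)
  else if h : (-t).toNat < p then fun a => X 0 ω (⟨(-t).toNat, h⟩, a) else 0

theorem obsOfStates_natCast {𝒮 : Type*} (X : ℕ → 𝒮 → Fin p × Fin d → ℝ) (t : ℕ) (ω : 𝒮) :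
    obsOfStates X t ω = fun a => X t ω (0, a) := by
  simp [obsOfStates]

/-- Consecutive states overlap in all but one block, so the leading blocks, with the initial state
supplying the earlier times, recover every state. -/
theorem stack_obsOfStates {𝒮 : Type*} {X : ℕ → 𝒮 → Fin p × Fin d → ℝ}
    {u : ℕ → 𝒮 → Fin d → ℝ} (hX : ∀ t ω, X (t + 1) ω = pushObs (X t ω) (u t ω)) (t : ℕ) :
    stack p (obsOfStates X) t = X t := by
  ext ω ⟨⟨i, hi⟩, a⟩
  induction t generalizing i with
  | zero =>
    rcases i with - | i
    · simp [stack, obsOfStates]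
    · have h1 : (-(((0 : ℕ) : ℤ) - ((i + 1 : ℕ) : ℤ))).toNat = i + 1 := by omega
      simp only [stack, obsOfStates]
      rw [if_neg (by omega), dif_pos (h1.trans_lt hi)]
      simp only [h1]
  | succ t ih =>
    rcases i with - | i
    · have := congrFun (obsOfStates_natCast X (t + 1) ω) a
      simpa [stack] using this
    · rw [hX, pushObs_succ, ← ih i (by omega)]
      simp only [stack]
      rw [show (((t + 1 : ℕ) : ℤ) - ((i + 1 : ℕ) : ℤ)) = (t : ℤ) - (i : ℤ) by push_cast; ring]

/-- The σ-algebra is arbitrary so that the lemma also serves for `coordsBefore`; negative times need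
only `X 0`. -/
theorem measurable_obsOfStates {𝒮 : Type*} {m : MeasurableSpace 𝒮}
    {X : ℕ → 𝒮 → Fin p × Fin d → ℝ} (t : ℤ) (hX : ∀ k : ℕ, k ≤ t.toNat → Measurable (X k)) :
    Measurable (obsOfStates X t) := by
  unfold obsOfStates
  split_ifs with h1 h2
  · exact measurable_pi_lambda _ fun a => (measurable_pi_apply _).comp (hX _ le_rfl)
  · exact measurable_pi_lambda _ fun a => (measurable_pi_apply _).comp (hX _ (Nat.zero_le _))
  · exact measurable_const

theorem coeffRow_mulVec_stack {p : ℕ} {𝒮 : Type*}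
    (A : Fin p → Matrix (Fin d) (Fin d) ℝ)
    (z : ℤ → 𝒮 → Fin d → ℝ) (t : ℤ) (ω : 𝒮) :
    coeffRow A *ᵥ stack p z (t - 1) ω = ∑ i : Fin p, A i *ᵥ z (t - (((i : ℕ) : ℤ) + 1)) ω := by
  ext a
  simp only [mulVec, dotProduct, coeffRow, stack, Matrix.of_apply, Fintype.sum_prod_type,
    Finset.sum_apply]
  refine Finset.sum_congr rfl fun i _ => Finset.sum_congr rfl fun b _ => ?_
  rw [show t - 1 - ((i : ℕ) : ℤ) = t - (((i : ℕ) : ℤ) + 1) by ring]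

end Observations

end StudentVAR


/-! ### Assembly of the process. -/

theorem theorem1 {d p : ℕ} [NeZero d] [NeZero p]
    (φ₀ : Fin d → ℝ) (A : Fin p → Matrix (Fin d) (Fin d) ℝ) (hA : StudentVAR.Stable A)
    (Ω : Matrix (Fin d) (Fin d) ℝ) (hΩ : Ω.PosDef) (ν : ℝ) (hν : 2 < ν) :
    ∃ (κ : Kernel (Fin p × Fin d → ℝ) (Fin d → ℝ))
      (K : Kernel (Fin p × Fin d → ℝ) (Fin p × Fin d → ℝ)),
      IsMarkovKernel K ∧
      -- the conditional law of the next observation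
      (∀ v, StudentVAR.IsStudentT (κ v) (StudentVAR.condMean φ₀ A v)
        (StudentVAR.condCov φ₀ A Ω ν v) (ν + (d : ℝ) * (p : ℝ))) ∧
      -- the stationary distribution of the chain
      StudentVAR.IsStudentT
        (StudentVAR.studentT (StudentVAR.stackMu φ₀ A) (StudentVAR.sigmaP A Ω) ν)
        (StudentVAR.stackMu φ₀ A) (StudentVAR.sigmaP A Ω) ν ∧
      Kernel.Invariant K
        (StudentVAR.studentT (StudentVAR.stackMu φ₀ A) (StudentVAR.sigmaP A Ω) ν) ∧
      -- the process, for every initial distribution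
      ∀ π₀ : Measure (Fin p × Fin d → ℝ), IsProbabilityMeasure π₀ →
        ∃ (𝒮 : Type) (_ : MeasurableSpace 𝒮) (P : Measure 𝒮) (z : ℤ → 𝒮 → Fin d → ℝ)
          (ε : ℕ → 𝒮 → Fin d → ℝ),
          IsProbabilityMeasure P ∧
          (∀ t, Measurable (z t)) ∧ (∀ t, Measurable (ε t)) ∧
          P.map (StudentVAR.stack p z 0) = π₀ ∧
          StudentVAR.IsMarkovChain P (fun t : ℕ => StudentVAR.stack p z t) K ∧
          (π₀ = StudentVAR.studentT (StudentVAR.stackMu φ₀ A) (StudentVAR.sigmaP A Ω) ν →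
            ∀ t : ℕ, 1 ≤ t →
              StudentVAR.IsStudentT (P.map (StudentVAR.stackSucc p z t))
                (StudentVAR.stackMuSucc φ₀ A) (StudentVAR.sigmaSucc A Ω) ν) ∧
          (∀ t : ℕ, 1 ≤ t →
            HasCondDistrib (z t) (StudentVAR.stack p z ((t : ℤ) - 1)) κ P) ∧
          -- the autoregressive representation with independent, identically distributed errors
          (∀ t : ℕ, 1 ≤ t → StudentVAR.IsStudentT (P.map (ε t)) 0 1 (ν + (d : ℝ) * (p : ℝ))) ∧
          iIndepFun (fun t : {t : ℕ // 1 ≤ t} => ε t) P ∧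
          (∀ t : ℕ, 1 ≤ t →
            Indep (MeasurableSpace.comap (ε t) inferInstance) (StudentVAR.past p z t) P) ∧
          (∀ t : ℕ, 1 ≤ t → ∀ ω,
            z t ω = φ₀ + ∑ i : Fin p, A i *ᵥ z ((t : ℤ) - (((i : ℕ) : ℤ) + 1)) ω +
              CFC.sqrt (StudentVAR.condCov φ₀ A Ω ν (StudentVAR.stack p z ((t : ℤ) - 1) ω)) *ᵥ
                ε t ω) := by
  have hν' := StudentVAR.two_lt_add_mul d p hν
  set Q := StudentVAR.studentT (0 : Fin d → ℝ) 1 (ν + (d : ℝ) * (p : ℝ)) with hQ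
  set π := StudentVAR.studentT (StudentVAR.stackMu φ₀ A) (StudentVAR.sigmaP A Ω) ν with hπ
  have hQt : StudentVAR.IsStudentT Q 0 1 (ν + (d : ℝ) * (p : ℝ)) :=
    StudentVAR.isStudentT_zero_one hν'
  have hQp := hQt.isProbabilityMeasure
  have hU := StudentVAR.measurable_nextObs (φ₀ := φ₀) hA hΩ hν
  have hT := StudentVAR.measurable_nextState (φ₀ := φ₀) hA hΩ hν
  have hinv := StudentVAR.invariant_noiseKernel_nextState (φ₀ := φ₀) hA hΩ hν
  refine ⟨StudentVAR.noiseKernel (StudentVAR.nextObs φ₀ A Ω ν) Q,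
    StudentVAR.noiseKernel (StudentVAR.nextState φ₀ A Ω ν) Q,
    StudentVAR.isMarkovKernel_noiseKernel hT Q, fun v => ?_,
    StudentVAR.isStudentT_studentT (StudentVAR.sigmaP_posDef hA hΩ) hν, hinv, fun π₀ hπ₀ => ?_⟩
  · rw [StudentVAR.noiseKernel_nextObs hA hΩ hν]
    exact StudentVAR.isStudentT_studentT (StudentVAR.condCov_posDef hA hΩ hν v) hν'
  set X := StudentVAR.recState (StudentVAR.nextState φ₀ A Ω ν)
  have hX : ∀ t ω, X (t + 1) ω
      = StudentVAR.pushObs (X t ω) (StudentVAR.nextObs φ₀ A Ω ν (X t ω, (ω (t + 1)).2)) :=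
    fun t ω => rfl
  have hstack : ∀ t : ℕ, StudentVAR.stack p (StudentVAR.obsOfStates X) t = X t :=
    StudentVAR.stack_obsOfStates hX
  have hXm := StudentVAR.measurable_recState hT
  have hsnd : (π₀.prod Q).map Prod.snd = Q := by simp [Measure.map_snd_prod]
  have hfst : (π₀.prod Q).map Prod.fst = π₀ := by simp [Measure.map_fst_prod]
  have hz : ∀ (t : ℕ) ω, StudentVAR.obsOfStates X ((t + 1 : ℕ) : ℤ) ω
      = StudentVAR.nextObs φ₀ A Ω ν (X t ω, (ω (t + 1)).2) := by
    intro t ω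
    rw [StudentVAR.obsOfStates_natCast]
    ext a
    rw [hX, StudentVAR.pushObs_zero]
  have hlag : ∀ t : ℕ, (((t + 1 : ℕ) : ℤ) - 1) = (t : ℤ) := fun t => by push_cast; ring
  have hcond : ∀ t : ℕ, HasCondDistrib (StudentVAR.obsOfStates X ((t + 1 : ℕ) : ℤ)) (X t)
      (StudentVAR.noiseKernel (StudentVAR.nextObs φ₀ A Ω ν) Q)
      (Measure.infinitePi fun _ : ℕ => π₀.prod Q) := by
    intro t
    have h := StudentVAR.hasCondDistrib_recState (R := π₀.prod Q) hT hU t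
    rw [hsnd] at h
    rwa [show StudentVAR.obsOfStates X ((t + 1 : ℕ) : ℤ) = _ from funext (hz t)]
  -- The coordinates are i.i.d. with law `π₀.prod Q`. The recursion uses the first entry only at
  -- time `0` and the second entry only from time `1` on.
  refine ⟨ℕ → (Fin p × Fin d → ℝ) × (Fin d → ℝ), inferInstance,
    Measure.infinitePi fun _ : ℕ => π₀.prod Q, StudentVAR.obsOfStates X, fun t ω => (ω t).2,
    inferInstance, fun t => StudentVAR.measurable_obsOfStates t fun k _ => hXm k,
    fun t => measurable_snd.comp (measurable_pi_apply t), ?_, ?_, ?_, ?_, ?_, ?_, ?_, ?_⟩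
  · rw [show (0 : ℤ) = ((0 : ℕ) : ℤ) from rfl, hstack, StudentVAR.map_recState_zero, hfst]
  · simp_rw [hstack]
    have h := StudentVAR.isMarkovChain_recState (R := π₀.prod Q) hT
    rwa [hsnd] at h
  · rintro rfl t ht
    obtain ⟨t, rfl⟩ := Nat.exists_eq_add_of_le' ht
    have hlaw := StudentVAR.map_recState_of_invariant (R := π.prod Q) hT
      (by rw [hsnd, hfst]; exact hinv) t
    rw [hfst] at hlaw
    have h := (hcond t).map_eq
    rw [show (Measure.infinitePi fun _ : ℕ => π.prod Q).map (X t) = π from hlaw] at h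
    have h2 : StudentVAR.stackSucc p (StudentVAR.obsOfStates X) ((t + 1 : ℕ) : ℤ)
        = (fun vu => Sum.elim vu.2 vu.1) ∘
          fun ω => (X t ω, StudentVAR.obsOfStates X ((t + 1 : ℕ) : ℤ) ω) := by
      ext1 ω
      rw [StudentVAR.stackSucc, hlag, hstack]
      rfl
    rw [h2, ← Measure.map_map StudentVAR.measurable_sumElim_swap
      ((hXm t).prodMk (StudentVAR.measurable_obsOfStates _ fun k _ => hXm k)), h,
      StudentVAR.compProd_noiseKernel_nextObs hA hΩ hν]
    exact StudentVAR.isStudentT_studentT (StudentVAR.sigmaSucc_posDef hA hΩ) hν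
  · intro t ht
    obtain ⟨t, rfl⟩ := Nat.exists_eq_add_of_le' ht
    rw [hlag, hstack]
    exact hcond t
  · intro t _
    rw [StudentVAR.map_noise, hsnd]
    exact hQt
  · exact StudentVAR.iIndepFun_noise.precomp Subtype.val_injective
  · intro t ht
    refine StudentVAR.indep_noise_of_le (iSup₂_le fun s hs => ?_)
    refine Measurable.comap_le (StudentVAR.measurable_obsOfStates s fun k hk =>
      StudentVAR.measurable_coordsBefore_recState hT ?_)
    -- Times `s ≤ 0` are read off `X 0`, hence off coordinate `0`, which precedes `t` because `1 ≤
    -- t`.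
    have := hs.2
    omega
  · intro t ht ω
    obtain ⟨t, rfl⟩ := Nat.exists_eq_add_of_le' ht
    rw [← StudentVAR.coeffRow_mulVec_stack, hlag, hstack, hz]
    rfl
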